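/- Let $d\ge 1$ and let $\mathcal M(\mathbb R^d)$ be the space of finite signed Borel measures on $\mathbb R^d$ with the total variation norm $\|\mu\|_1=|\mu|(\mathbb R^d)$. Call a function $f:\mathbb R^d\to\mathbb R$ of type $(\mathcal H_0)$ if it is bounded, continuous, symmetric ($f(-x)=f(x)$) and of positive definite type ($\sum_{i,j} f(x_i-x_j)z_i\bar z_j\ge 0$ for all finite families $x_i\in\mathbb R^d$, $z_i\in\mathbb C$); its spectral measure is the finite nonnegative measure $\Lambda_f$ with $f(x)=\int e^{\imath x^\top\omega}\,d\Lambda_f(\omega)$. Let $\varphi$ be a probability density on $\mathbb R^d$ of type $(\mathcal H_0)$, with spectral density $\sigma$ (so that $\Lambda_\varphi=\sigma(\omega)\,d\omega$), and let $\lambda$ be of type $(\mathcal H_0)$ and vanish at infinity, with spectral measure $\Lambda$. Let $\mathbb L$ be the reproducing kernel Hilbert space with kernel $(x,y)\mapsto\lambda(x-y)$. For $\mu\in\mathcal M(\mathbb R^d)$ put $\Phi\mu=\varphi\star\mu$ and $L\mu=\lambda\star\mu\in\mathbb L$; $\Phi\mu$ is also regarded as the measure with density $\Phi\mu$, so that $L\circ\Phi\mu\in\mathbb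 L$, and for $c\in\mathbb L$ put $\Phi c=\varphi\star c$. Let $X_1,\dots,X_n\in\mathbb R^d$ ($n\ge1$) be arbitrary points, $\hat f_n=\frac1n\sum_{i=1}^n\delta_{X_i}$ and $\kappa>0$. Consider the primal program $$(\mathbf P_\kappa)\qquad \inf_{\mu\in\mathcal M(\mathbb R^d)}\Big\{\tfrac12\|L\hat f_n-L\circ\Phi\mu\|_{\mathbb L}^2+\kappa\|\mu\|_1\Big\},$$ the Lagrangian $\mathcal L(\mu,z,c)=\frac12\|L\hat f_n-z\|_{\mathbb L}^2+\kappa\|\mu\|_1-\langle c,L\circ\Phi\mu-z\rangle_{\mathbb L}$ for $\mu\in\mathcal M(\mathbb R^d)$, $z,c\in\mathbb L$, and the dual program $$(\mathbf P_\kappa^*)\qquad \sup_{c\in\mathbb L}D(c),\qquad D(c)=\inf_{\mu\in\mathcal M(\mathbb R^d),\,z\in\mathbb L}\mathcal L(\mu,z,c).$$ Then the following hold. (i) $(\mathbf P_\kappa)$ has at least one solution, and $\hat z_n:=L\circ\Phi\hat\mu_n$ and $\hat m_n:=\|\hat\mu_n\|_1$ are the same for all solutions $\hat\mu_n$. (ii)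 $D(c)=\frac12\|L\hat f_n\|_{\mathbb L}^2-\frac12\|L\hat f_n-c\|_{\mathbb L}^2$ if $\|\Phi c\|_\infty\le\kappa$ and $D(c)=-\infty$ otherwise; hence the value of $(\mathbf P_\kappa^*)$ is $$\tfrac12\|L\hat f_n\|_{\mathbb L}^2-\inf\Big\{\tfrac12\|L\hat f_n-c\|_{\mathbb L}^2:\ c\in\mathbb L,\ \|\Phi c\|_\infty\le\kappa\Big\}.$$ There is no duality gap: the values of $(\mathbf P_\kappa)$ and $(\mathbf P_\kappa^*)$ are equal. The dual program has a unique solution, $\hat c_n=L\hat f_n-\hat z_n$. (iii) Put $\hat\eta_n:=\Phi\hat c_n/\kappa$. Every solution $\hat\mu_n$ of $(\mathbf P_\kappa)$ satisfies $$\mathrm{Supp}(\hat\mu_n)\subseteq\{x\in\mathbb R^d:\ |\hat\eta_n(x)|=1\}\quad\text{and}\quad\int_{\mathbb R^d}\hat\eta_n\,d\hat\mu_n=\hat m_n,$$ and $\hat\eta_n$ is a sub-gradient of the total variation norm at $\hat\mu_n$, i.e. $\|\nu\|_1\ge\|\hat\mu_n\|_1+\int\hat\eta_n\,d(\nu-\hat\mu_n)$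 for all $\nu\in\mathcal M(\mathbb R^d)$. (iv) If $d=1$ and at least one of the spectral measures $\Lambda$ and $\sigma(\omega)\,d\omega$ has bounded support, then $\{x\in\mathbb R:\ |\hat\eta_n(x)|=1\}$ is discrete with no accumulation point, and every solution $\hat\mu_n$ of $(\mathbf P_\kappa)$ has an at most countable support $\hat S\subset\mathbb R$ with no accumulation point, with $\hat\mu_n=\sum_{t\in\hat S}\hat a_t\delta_t$ for real coefficients $\hat a_t$. -/

import Mathlib

open MeasureTheory Filter Topology
open scoped ENNReal ComplexOrder

noncomputable section

namespace Blasso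

/-- The Euclidean space `ℝ^d`. -/
abbrev E (d : ℕ) := EuclideanSpace ℝ (Fin d)

/-- Bounded continuous symmetric function of positive definite type. -/
structure IsPosDefType {d : ℕ} (f : E d → ℝ) : Prop where
  bounded : ∃ C, ∀ x, |f x| ≤ C
  continuous : Continuous f
  symm : ∀ x, f (-x) = f x
  nonneg_sum : ∀ (N : ℕ) (x : Fin N → E d) (z : Fin N → ℂ),
    0 ≤ ∑ i, ∑ j, (f (x i - x j) : ℂ) * z i * (starRingEnd ℂ) (z j)

/-- Probability density with respect to Lebesgue measure. -/
structure IsProbDensity {d : ℕ} (f : E d → ℝ) : Prop where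
  nonneg : ∀ x, 0 ≤ f x
  integrable : Integrable f
  integral_eq_one : ∫ x, f x = 1

/-- `Λ` is the spectral measure of `f`: a finite nonnegative measure with
`f x = ∫ exp (i ⟪x, ω⟫) dΛ(ω)` for all `x`. -/
def IsSpectralMeasure {d : ℕ} (f : E d → ℝ) (Λ : Measure (E d)) : Prop :=
  IsFiniteMeasure Λ ∧ ∀ x, (f x : ℂ) = charFun Λ x

/-- The spectral measure of `f` has bounded support. -/
def HasBoundedSpectrum {d : ℕ} (f : E d → ℝ) : Prop :=
  ∃ Λ : Measure (E d), IsSpectralMeasure f Λ ∧ Bornology.IsBounded Λ.support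

/-- The total variation norm `‖μ‖₁`. -/
def tvNorm {d : ℕ} (μ : SignedMeasure (E d)) : ℝ := μ.totalVariation.real Set.univ

/-- Convolution of a function with a signed measure, `x ↦ ∫ f (x - y) dμ(y)`. -/
def convMeasure {d : ℕ} (f : E d → ℝ) (μ : SignedMeasure (E d)) (x : E d) : ℝ :=
  ∫ᵛ y, f (x - y) ∂<•μ

/-- Convolution of two functions, `x ↦ ∫ f t * g (x - t) dt`. -/
def convFun {d : ℕ} (f g : E d → ℝ) : E d → ℝ :=
  convolution f g (ContinuousLinearMap.lsmul ℝ ℝ) volume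

/-- The supremum norm, as an extended nonnegative number. -/
def supNorm {d : ℕ} (f : E d → ℝ) : ℝ≥0∞ := ⨆ x, ‖f x‖ₑ

/-- The empirical measure `(1/n) ∑ δ_{X_i}`. -/
def empirical {d n : ℕ} (X : Fin n → E d) : SignedMeasure (E d) :=
  (n : ℝ)⁻¹ • ∑ i, (Measure.dirac (X i)).toSignedMeasure

section RKHS

variable {d : ℕ} (H : Type*) [NormedAddCommGroup H] [InnerProductSpace ℝ H] [CompleteSpace H]
  [RKHS ℝ H (E d) ℝ]

/-- `lam (x - y)` is the reproducing kernel of `H`. -/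
def HasKernel (lam : E d → ℝ) : Prop :=
  ∀ x y, RKHS.kernel H x y 1 = lam (x - y)

/-- The operator `L`: the element of the reproducing kernel Hilbert space given by
`∫ k(·, y) dν(y)`. As a function it is the convolution of the kernel with `ν`, see
`embed_apply`. -/
def embed (ν : SignedMeasure (E d)) : H := ∫ᵛ y, RKHS.kerFun H y 1 ∂<•ν

/-- The operator `L ∘ Φ`, where `Φ μ = φ ⋆ μ` is identified with the measure of density `φ ⋆ μ`. -/
def embedConv (φ : E d → ℝ) (μ : SignedMeasure (E d)) : H :=
  embed H (volume.withDensityᵥ (convMeasure φ μ))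

/-- The objective function of the primal program. -/
def primalObj (φ : E d → ℝ) (κ : ℝ) {n : ℕ} (X : Fin n → E d) (μ : SignedMeasure (E d)) : ℝ :=
  1 / 2 * ‖embed H (empirical X) - embedConv H φ μ‖ ^ 2 + κ * tvNorm μ

/-- `μ` is a solution of the primal program. -/
def IsPrimalSol (φ : E d → ℝ) (κ : ℝ) {n : ℕ} (X : Fin n → E d) (μ : SignedMeasure (E d)) :
    Prop :=
  ∀ ν, primalObj H φ κ X μ ≤ primalObj H φ κ X ν

variable {H}

/-- The Lagrangian. -/
def lagrangian (φ : E d → ℝ) (κ : ℝ) {n : ℕ} (X : Fin n → E d) (μ : SignedMeasure (E d))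
    (z c : H) : ℝ :=
  1 / 2 * ‖embed H (empirical X) - z‖ ^ 2 + κ * tvNorm μ - inner ℝ c (embedConv H φ μ - z)

/-- The objective function of the dual program, `c ↦ inf_{μ, z} lagrangian(μ, z, c)`. -/
def dualObj (φ : E d → ℝ) (κ : ℝ) {n : ℕ} (X : Fin n → E d) (c : H) : EReal :=
  ⨅ p : SignedMeasure (E d) × H, (lagrangian φ κ X p.1 p.2 c : EReal)

/-- `c` is a solution of the dual program `sup_c inf_{μ, z} lagrangian(μ, z, c)`. -/
def IsDualSol (φ : E d → ℝ) (κ : ℝ) {n : ℕ} (X : Fin n → E d) (c : H) : Prop :=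
  ∀ c' : H, dualObj φ κ X c' ≤ dualObj φ κ X c

/-- The dual constraint `‖Φ c‖_∞ ≤ κ`. -/
def DualFeasible (φ : E d → ℝ) (κ : ℝ) (c : H) : Prop :=
  supNorm (convFun φ (c : E d → ℝ)) ≤ ENNReal.ofReal κ

variable (H)

theorem continuous_kerFun {lam : E d → ℝ} (hl : IsPosDefType lam) (hk : HasKernel H lam) :
    Continuous fun y : E d => (RKHS.kerFun H y 1 : H) := by
  have key : ∀ x y : E d, inner ℝ (RKHS.kerFun H y 1 : H) (RKHS.kerFun H x 1) = lam (y - x) := by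
    intro x y
    rw [RKHS.inner_kerFun, RKHS.kerFun_apply]
    have := hk x y
    rw [this, ← hl.symm (x - y), neg_sub]
    simp
  rw [continuous_iff_continuousAt]
  intro y₀
  rw [ContinuousAt, tendsto_iff_norm_sub_tendsto_zero]
  have h1 : ∀ y : E d, ‖(RKHS.kerFun H y 1 : H) - RKHS.kerFun H y₀ 1‖
      = √(2 * lam 0 - 2 * lam (y - y₀)) := by
    intro y
    rw [← Real.sqrt_sq (norm_nonneg _), norm_sub_sq_real, ← real_inner_self_eq_norm_sq,
      ← real_inner_self_eq_norm_sq, key, key, key]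
    congr 1
    simp only [sub_self]
    ring
  simp_rw [h1]
  have hc := hl.continuous
  have h2 : Continuous fun y : E d => √(2 * lam 0 - 2 * lam (y - y₀)) := by fun_prop
  simpa using h2.tendsto y₀

theorem signed_eq (ν : SignedMeasure (E d)) : ν = ν.toJordanDecomposition.posPart.toSignedMeasure
    - ν.toJordanDecomposition.negPart.toSignedMeasure :=
  (ν.toSignedMeasure_toJordanDecomposition).symm

/-- Integral of a bounded continuous function through the Jordan decomposition. -/
theorem integral_signed {G : Type*} [NormedAddCommGroup G] [NormedSpace ℝ G]
    (ν : SignedMeasure (E d)) (f : E d → G)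
    (hp : Integrable f ν.toJordanDecomposition.posPart)
    (hn : Integrable f ν.toJordanDecomposition.negPart) :
    ∫ᵛ y, f y ∂<•ν = ∫ y, f y ∂ν.toJordanDecomposition.posPart
      - ∫ y, f y ∂ν.toJordanDecomposition.negPart := by
  conv_lhs => rw [signed_eq ν]
  rw [VectorMeasure.integral_sub_vectorMeasure, VectorMeasure.integral_toSignedMeasure,
    VectorMeasure.integral_toSignedMeasure]
  · simpa [VectorMeasure.Integrable] using hp
  · simpa [VectorMeasure.Integrable] using hn

/-- As a function, `embed H ν` is the convolution of the kernel with `ν`. -/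
theorem embed_apply {lam : E d → ℝ} (hl : IsPosDefType lam) (hk : HasKernel H lam)
    (ν : SignedMeasure (E d)) (x : E d) : embed H ν x = convMeasure lam ν x := by
  have hc := continuous_kerFun H hl hk
  have hnorm : ∀ y : E d, ‖(RKHS.kerFun H y 1 : H)‖ ≤ √(lam 0) := by
    intro y
    apply Real.le_sqrt_of_sq_le
    rw [← real_inner_self_eq_norm_sq, RKHS.inner_kerFun, RKHS.kerFun_apply, hk y y]
    simp
  have hint : ∀ m : Measure (E d), IsFiniteMeasure m →
      Integrable (fun y : E d => (RKHS.kerFun H y 1 : H)) m := fun m _ =>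
    Integrable.of_bound hc.aestronglyMeasurable _ (Eventually.of_forall hnorm)
  obtain ⟨C, hC⟩ := hl.bounded
  have hlc := hl.continuous
  have hint2 : ∀ m : Measure (E d), IsFiniteMeasure m →
      Integrable (fun y : E d => lam (x - y)) m := fun m _ =>
    Integrable.of_bound (by fun_prop) C (Eventually.of_forall fun y => hC _)
  have hev : ∀ m : Measure (E d), IsFiniteMeasure m →
      inner ℝ (RKHS.kerFun H x 1 : H) (∫ y, (RKHS.kerFun H y 1 : H) ∂m) = ∫ y, lam (x - y) ∂m := by
    intro m hm
    rw [← integral_inner (hint m hm)]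
    congr 1
    ext y
    rw [RKHS.kerFun_inner, RKHS.kerFun_apply, hk x y]
    simp
  have h0 : embed H ν x = inner ℝ (RKHS.kerFun H x 1 : H) (embed H ν) := by
    rw [RKHS.kerFun_inner]; simp
  rw [h0, embed, convMeasure, integral_signed ν _ (hint _ inferInstance) (hint _ inferInstance),
    integral_signed ν _ (hint2 _ inferInstance) (hint2 _ inferInstance), inner_sub_right,
    hev _ inferInstance, hev _ inferInstance]

end RKHS

/-- `Φ μ = φ ⋆ μ` is integrable, hence the density of a signed measure. -/
theorem integrable_convMeasure {d : ℕ} {φ : E d → ℝ} (hφ : IsPosDefType φ)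
    (hd : IsProbDensity φ) (μ : SignedMeasure (E d)) : Integrable (convMeasure φ μ) := by
  obtain ⟨C, hC⟩ := hφ.bounded
  have hc := hφ.continuous
  have hint : ∀ (m : Measure (E d)) (x : E d), IsFiniteMeasure m →
      Integrable (fun y : E d => φ (x - y)) m := fun m x _ =>
    Integrable.of_bound (by fun_prop) C (Eventually.of_forall fun y => hC _)
  have h : ∀ m : Measure (E d), IsFiniteMeasure m →
      Integrable (fun x : E d => ∫ y, φ (x - y) ∂m) := by
    intro m hm
    have : Integrable (fun p : E d × E d => φ (p.1 - p.2)) (volume.prod m) := by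
      rw [integrable_prod_iff' (by fun_prop)]
      refine ⟨Eventually.of_forall fun y => hd.integrable.comp_sub_right y, ?_⟩
      have : ∀ y : E d, ∫ x, ‖φ (x - y)‖ = ∫ x, ‖φ x‖ := fun y =>
        integral_sub_right_eq_self (fun x => ‖φ x‖) y
      simp_rw [this]
      exact integrable_const _
    exact this.integral_prod_left
  have he : convMeasure φ μ = fun x => (∫ y, φ (x - y) ∂μ.toJordanDecomposition.posPart)
      - ∫ y, φ (x - y) ∂μ.toJordanDecomposition.negPart := by
    ext x
    exact integral_signed μ _ (hint _ x inferInstance) (hint _ x inferInstance)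
  rw [he]
  exact (h _ inferInstance).sub (h _ inferInstance)

end Blasso

end

/-! Everything rests on one identity: Φc(t) is the inner product of c with a vector `feature H φ t`
depending continuously on t. Hence L∘Φμ is the integral of this feature map against μ, and ⟨c, L∘Φμ⟩
= ∫ Φc dμ (`inner_embedConv`). The program becomes ½‖f − Tμ‖² + κ N(μ) with T linear and N a
seminorm.

In that setting a minimizer v satisfies ⟨f − Tv, Tw − Tv⟩ ≤ κ(N w − N v) for all w
(`inner_sub_le_of_minimizer`). Exchanging two minimizers gives the uniqueness claims. Testing with 0
and 2v gives ⟨f − Tv, Tv⟩ = κ N v, so the residual f − Tv is dual feasible and is the projection of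
f onto the feasible set; strong duality and the unique dual solution follow. `dualFeasible_iff`
identifies the abstract constraint with ‖Φc‖_∞ ≤ κ. Equality in ∫ η dμ ≤ ‖μ‖₁ with |η| ≤ 1 then
forces |η| = 1 on the support.

Existence is the direct method: a minimizing sequence is bounded in total variation, and its Jordan
parts have vague limits along an ultrafilter, by Riesz–Markov. Since λ vanishes at infinity, so does
every Φc, hence ∫ Φc dμ passes to the limit and the objective is lower semicontinuous
(`exists_isPrimalSol`).

For (iv), a function with bounded spectrum is reproduced by convolution with the inverse Fourier
transform of a smooth cutoff. Φc inherits this, and the kernel extends to an entire function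
decaying on horizontal strips, so Φc is real analytic. If {|η| = 1} had an accumulation point, η²
would be identically 1, contradicting decay at infinity. -/

noncomputable section

namespace Blasso

/-! ### Total variation norm and integration against signed measures. -/

section TotalVariation

variable {d : ℕ}

instance isFiniteMeasure_variation (μ : SignedMeasure (E d)) :
    IsFiniteMeasure (VectorMeasure.variation μ) := by
  rw [← SignedMeasure.totalVariation_eq_variation]
  infer_instance

theorem tvNorm_eq_variation (μ : SignedMeasure (E d)) :
    tvNorm μ = (VectorMeasure.variation μ).real Set.univ := by
  rw [tvNorm, SignedMeasure.totalVariation_eq_variation]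

theorem tvNorm_add_le (μ ν : SignedMeasure (E d)) : tvNorm (μ + ν) ≤ tvNorm μ + tvNorm ν := by
  simp_rw [tvNorm_eq_variation]
  rw [← measureReal_add_apply]
  exact ENNReal.toReal_mono (measure_ne_top _ _) (VectorMeasure.variation_add_le _)

theorem tvNorm_smul (a : ℝ) (μ : SignedMeasure (E d)) : tvNorm (a • μ) = ‖a‖ * tvNorm μ := by
  simp_rw [tvNorm_eq_variation]
  rw [VectorMeasure.variation_smul, measureReal_nnreal_smul_apply, coe_nnnorm]

variable (d) in
/-- The total variation norm, as a seminorm. -/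
def tvSeminorm : Seminorm ℝ (SignedMeasure (E d)) :=
  Seminorm.of tvNorm tvNorm_add_le tvNorm_smul

theorem tvSeminorm_apply (μ : SignedMeasure (E d)) : tvSeminorm d μ = tvNorm μ := rfl

theorem integrable_of_bounded {G : Type*} [NormedAddCommGroup G] {f : E d → G}
    (hc : Continuous f) {C : ℝ} (hC : ∀ x, ‖f x‖ ≤ C) (m : Measure (E d)) [IsFiniteMeasure m] :
    Integrable f m :=
  Integrable.of_bound hc.aestronglyMeasurable C (Eventually.of_forall hC)

theorem abs_integral_le_tvNorm {f : E d → ℝ} {C : ℝ} (hC : ∀ x, |f x| ≤ C)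
    (μ : SignedMeasure (E d)) : |∫ᵛ x, f x ∂<•μ| ≤ C * tvNorm μ := by
  have h := VectorMeasure.norm_integral_le_of_norm_le_const (μ := μ)
    (B := (ContinuousLinearMap.lsmul ℝ ℝ : ℝ →L[ℝ] ℝ →L[ℝ] ℝ).flip) (f := f) (C := C)
    (Eventually.of_forall hC)
  have hC0 : 0 ≤ C := (abs_nonneg _).trans (hC 0)
  have hB : ‖(ContinuousLinearMap.lsmul ℝ ℝ : ℝ →L[ℝ] ℝ →L[ℝ] ℝ).flip‖ ≤ 1 := by
    rw [ContinuousLinearMap.opNorm_flip]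
    exact ContinuousLinearMap.opNorm_lsmul_le
  rw [tvNorm_eq_variation]
  refine (h.trans ?_)
  gcongr
  exact mul_le_of_le_one_right hC0 hB

theorem tvNorm_eq_posPart_add_negPart (μ : SignedMeasure (E d)) :
    tvNorm μ = μ.toJordanDecomposition.posPart.real Set.univ
      + μ.toJordanDecomposition.negPart.real Set.univ := by
  rw [tvNorm, SignedMeasure.totalVariation, measureReal_add_apply]

theorem tvNorm_toSignedMeasure (m : Measure (E d)) [IsFiniteMeasure m] :
    tvNorm m.toSignedMeasure = m.real Set.univ := by
  rw [tvNorm_eq_variation, Measure.variation_toSignedMeasure]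

theorem tvNorm_sub_toSignedMeasure_le (p q : Measure (E d)) [IsFiniteMeasure p]
    [IsFiniteMeasure q] :
    tvNorm (p.toSignedMeasure - q.toSignedMeasure) ≤ p.real Set.univ + q.real Set.univ := by
  rw [← tvNorm_toSignedMeasure p, ← tvNorm_toSignedMeasure q]
  exact map_sub_le_add (tvSeminorm d) _ _

theorem integral_sub_toSignedMeasure {G : Type*} [NormedAddCommGroup G] [NormedSpace ℝ G]
    {p q : Measure (E d)} [IsFiniteMeasure p] [IsFiniteMeasure q] {f : E d → G}
    (hp : Integrable f p) (hq : Integrable f q) :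
    ∫ᵛ x, f x ∂<•(p.toSignedMeasure - q.toSignedMeasure) = ∫ x, f x ∂p - ∫ x, f x ∂q := by
  rw [VectorMeasure.integral_sub_vectorMeasure, VectorMeasure.integral_toSignedMeasure,
    VectorMeasure.integral_toSignedMeasure]
  · simpa [VectorMeasure.Integrable] using hp
  · simpa [VectorMeasure.Integrable] using hq

/-- Integration of a bounded function against a measure with density. -/
theorem integral_withDensityᵥ {G : Type*} [NormedAddCommGroup G] [NormedSpace ℝ G]
    {g : E d → ℝ} (hg : Integrable g) {f : E d → G} (hc : Continuous f) {C : ℝ}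
    (hC : ∀ x, ‖f x‖ ≤ C) :
    ∫ᵛ x, f x ∂<•(volume.withDensityᵥ g) = ∫ x, g x • f x := by
  rw [withDensityᵥ_eq_withDensity_pos_part_sub_withDensity_neg_part hg]
  have := isFiniteMeasure_withDensity_ofReal hg.2
  have := isFiniteMeasure_withDensity_ofReal hg.neg.2
  have hn : AEMeasurable (fun x => ENNReal.ofReal (-g x)) volume :=
    hg.aemeasurable.neg.ennreal_ofReal
  rw [integral_sub_toSignedMeasure (integrable_of_bounded hc hC _)
    (integrable_of_bounded hc hC _),
    integral_withDensity_eq_integral_toReal_smul₀ hg.aemeasurable.ennreal_ofReal (by simp),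
    integral_withDensity_eq_integral_toReal_smul₀ hn (by simp),
    ← integral_sub]
  · refine integral_congr_ae (Eventually.of_forall fun x => ?_)
    simp only [ENNReal.toReal_ofReal', ← sub_smul]
    congr 1
    rcases le_total (g x) 0 with h | h
    · rw [max_eq_right h, max_eq_left (by linarith)]; simp
    · rw [max_eq_left h, max_eq_right (by linarith)]; simp
  · refine (hg.pos_part).smul_bdd C hc.aestronglyMeasurable (Eventually.of_forall hC) |>.congr ?_
    exact Eventually.of_forall fun x => by simp [ENNReal.toReal_ofReal']
  · refine (hg.neg_part).smul_bdd C hc.aestronglyMeasurable (Eventually.of_forall hC) |>.congr ?_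
    exact Eventually.of_forall fun x => by simp [ENNReal.toReal_ofReal']

end TotalVariation

/-! ### The feature map representing Φ, and decay at infinity. -/

section Feature

variable {d : ℕ} {φ lam : E d → ℝ} {H : Type*} [NormedAddCommGroup H] [InnerProductSpace ℝ H]
  [CompleteSpace H] [RKHS ℝ H (E d) ℝ]

theorem inner_kerFun_one (c : H) (x : E d) : inner ℝ c (RKHS.kerFun H x 1 : H) = c x := by
  rw [RKHS.inner_kerFun]; simp

theorem kerFun_one_apply (hk : HasKernel H lam) (x y : E d) :
    (RKHS.kerFun H y 1 : H) x = lam (x - y) := by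
  rw [RKHS.kerFun_apply, hk]

theorem norm_kerFun_one_le (hk : HasKernel H lam) (y : E d) :
    ‖(RKHS.kerFun H y 1 : H)‖ ≤ √(lam 0) := by
  apply Real.le_sqrt_of_sq_le
  rw [← real_inner_self_eq_norm_sq, inner_kerFun_one, kerFun_one_apply hk, sub_self]

theorem abs_apply_le (hk : HasKernel H lam) (c : H) (x : E d) : |c x| ≤ ‖c‖ * √(lam 0) := by
  rw [← inner_kerFun_one]
  exact (abs_real_inner_le_norm _ _).trans (by gcongr; exact norm_kerFun_one_le hk x)

theorem continuous_coe (hl : IsPosDefType lam) (hk : HasKernel H lam) (c : H) :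
    Continuous (c : E d → ℝ) := by
  have : (c : E d → ℝ) = fun x => inner ℝ c (RKHS.kerFun H x 1 : H) := by
    ext x; rw [inner_kerFun_one]
  rw [this]
  exact continuous_const.inner (continuous_kerFun H hl hk)

/-- Functions of a reproducing kernel Hilbert space whose kernel vanishes at infinity vanish at
infinity. -/
theorem tendsto_coe_cocompact (hk : HasKernel H lam)
    (h0 : Tendsto lam (cocompact (E d)) (𝓝 0)) (c : H) :
    Tendsto (c : E d → ℝ) (cocompact (E d)) (𝓝 0) := by
  let S : Submodule ℝ H :=
    { carrier := {c | Tendsto (c : E d → ℝ) (cocompact (E d)) (𝓝 0)}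
      add_mem' := fun {a b} ha hb => by
        have : Tendsto ((a : E d → ℝ) + (b : E d → ℝ)) (cocompact (E d)) (𝓝 (0 + 0)) :=
          Tendsto.add ha hb
        simpa using this
      zero_mem' := by
        simp only [Set.mem_ofPred_eq, RKHS.coe_zero]
        exact tendsto_const_nhds
      smul_mem' := fun r a ha => by
        have : Tendsto (r • (a : E d → ℝ)) (cocompact (E d)) (𝓝 (r • 0)) :=
          Tendsto.const_smul ha r
        simpa using this }
  -- The bound |c x| ≤ ‖c‖ √(λ 0) makes norm convergence uniform, and uniform limits keep the limit
  -- 0 at infinity. The kernel sections are translates of λ and span a dense subspace.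
  have hS : IsClosed (S : Set H) := by
    rw [← isSeqClosed_iff_isClosed]
    intro u c hu hc
    have hunif : TendstoUniformly (fun n => (u n : E d → ℝ)) c atTop := by
      rw [Metric.tendstoUniformly_iff]
      intro ε hε
      have hn := (tendsto_iff_norm_sub_tendsto_zero.mp hc).mul_const (√(lam 0))
      rw [zero_mul] at hn
      filter_upwards [hn.eventually (gt_mem_nhds hε)] with n hn x
      rw [dist_comm, Real.dist_eq]
      calc |u n x - c x| = |(u n - c : H) x| := by simp
        _ ≤ _ := abs_apply_le hk _ _
        _ < ε := hn
    exact hunif.tendsto_of_eventually_tendsto (Eventually.of_forall hu) tendsto_const_nhds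
  have hspan : Submodule.span ℝ {f : H | ∃ x v, RKHS.kerFun H x v = f} ≤ S := by
    rw [Submodule.span_le]
    rintro _ ⟨x, v, rfl⟩
    have h1 : (RKHS.kerFun H x v : H) = v • RKHS.kerFun H x 1 := by
      rw [← map_smul]; simp
    rw [h1]
    apply S.smul_mem
    change Tendsto ((RKHS.kerFun H x 1 : H) : E d → ℝ) (cocompact (E d)) (𝓝 0)
    have h2 : ((RKHS.kerFun H x 1 : H) : E d → ℝ) = lam ∘ (Homeomorph.subRight x) := by
      ext y; rw [kerFun_one_apply hk]; rfl
    rw [h2]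
    exact h0.comp (Homeomorph.subRight x).isClosedEmbedding.tendsto_cocompact
  have htop := (Submodule.topologicalClosure_mono hspan).trans_eq
    (IsClosed.submodule_topologicalClosure_eq hS)
  rw [RKHS.kerFun_dense] at htop
  exact htop (Submodule.mem_top : c ∈ ⊤)

variable (H) in
/-- The representer `∫ φ s • k(·, t - s) ds` of the evaluation of `φ ⋆ c` at `t`. -/
def feature (φ : E d → ℝ) (t : E d) : H := ∫ s, φ s • (RKHS.kerFun H (t - s) 1 : H)

theorem integrable_feature (hl : IsPosDefType lam) (hk : HasKernel H lam) (hφ : Integrable φ)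
    (t : E d) : Integrable fun s => φ s • (RKHS.kerFun H (t - s) 1 : H) :=
  hφ.smul_bdd (√(lam 0)) (((continuous_kerFun H hl hk).comp (continuous_const.sub continuous_id)
    ).aestronglyMeasurable) (Eventually.of_forall fun s => norm_kerFun_one_le hk (t - s))

theorem continuous_feature (hl : IsPosDefType lam) (hk : HasKernel H lam) (hφ : Integrable φ) :
    Continuous (feature H φ) := by
  refine continuous_of_dominated (bound := fun s => ‖φ s‖ * √(lam 0))
    (fun t => (integrable_feature hl hk hφ t).aestronglyMeasurable)
    (fun t => Eventually.of_forall fun s => ?_) (hφ.norm.mul_const _)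
    (Eventually.of_forall fun s => ?_)
  · rw [norm_smul]; gcongr; exact norm_kerFun_one_le hk _
  · exact ((continuous_kerFun H hl hk).comp (continuous_id.sub continuous_const)).const_smul _

theorem norm_feature_le (hk : HasKernel H lam) (hφ : Integrable φ) (t : E d) :
    ‖feature H φ t‖ ≤ (∫ s, ‖φ s‖) * √(lam 0) := by
  rw [← integral_mul_const]
  refine norm_integral_le_of_norm_le (hφ.norm.mul_const _) (Eventually.of_forall fun s => ?_)
  rw [norm_smul]; gcongr; exact norm_kerFun_one_le hk _

theorem inner_feature (hl : IsPosDefType lam) (hk : HasKernel H lam) (hφ : Integrable φ) (c : H)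
    (t : E d) : inner ℝ c (feature H φ t) = convFun φ c t := by
  rw [feature, ← integral_inner (integrable_feature hl hk hφ t), convFun, convolution]
  congr 1
  ext s
  rw [inner_smul_right, inner_kerFun_one]
  simp

theorem continuous_convFun (hl : IsPosDefType lam) (hk : HasKernel H lam) (hφ : Integrable φ)
    (c : H) : Continuous (convFun φ c) := by
  have : convFun φ c = fun t => inner ℝ c (feature H φ t) := by
    ext t; rw [inner_feature hl hk hφ]
  rw [this]
  exact continuous_const.inner (continuous_feature hl hk hφ)

theorem abs_convFun_le (hl : IsPosDefType lam) (hk : HasKernel H lam) (hφ : Integrable φ)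
    (c : H) (t : E d) : |convFun φ c t| ≤ ‖c‖ * ((∫ s, ‖φ s‖) * √(lam 0)) := by
  rw [← inner_feature hl hk hφ]
  exact (abs_real_inner_le_norm _ _).trans (by gcongr; exact norm_feature_le hk hφ t)

theorem tendsto_convFun_cocompact (hl : IsPosDefType lam) (hk : HasKernel H lam)
    (h0 : Tendsto lam (cocompact (E d)) (𝓝 0)) (hφ : Integrable φ) (c : H) :
    Tendsto (convFun φ c) (cocompact (E d)) (𝓝 0) := by
  have hc := continuous_coe hl hk c
  -- Dominated convergence along a filter needs countable generation.
  have hcg : (cocompact (E d)).IsCountablyGenerated := by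
    rw [← Metric.cobounded_eq_cocompact, ← comap_norm_atTop]
    infer_instance
  have key : Tendsto (fun t => ∫ s, φ s * c (t - s)) (cocompact (E d)) (𝓝 (∫ _ : E d, (0 : ℝ))) := by
    refine tendsto_integral_filter_of_dominated_convergence (fun s => ‖φ s‖ * (‖c‖ * √(lam 0)))
      (Eventually.of_forall fun t => hφ.aestronglyMeasurable.mul
        (hc.comp (continuous_const.sub continuous_id)).aestronglyMeasurable)
      (Eventually.of_forall fun t => Eventually.of_forall fun s => ?_) (hφ.norm.mul_const _)
      (Eventually.of_forall fun s => ?_)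
    · rw [norm_mul]; gcongr; exact abs_apply_le hk c _
    · have h1 : Tendsto (fun t : E d => c (t - s)) (cocompact (E d)) (𝓝 0) :=
        (tendsto_coe_cocompact hk h0 c).comp
          (Homeomorph.subRight s).isClosedEmbedding.tendsto_cocompact
      simpa using h1.const_mul (φ s)
  simp only [integral_zero] at key
  exact key

/-- `L ∘ Φ` is integration of the feature map. -/
theorem embedConv_eq_integral_feature (hp : IsPosDefType φ) (hd : IsProbDensity φ)
    (hl : IsPosDefType lam) (hk : HasKernel H lam) (μ : SignedMeasure (E d)) :
    embedConv H φ μ = ∫ᵛ t, feature H φ t ∂<•μ := by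
  have hφ := hd.integrable
  have hkc := continuous_kerFun H hl hk
  obtain ⟨C, hC⟩ := hp.bounded
  have hpc := hp.continuous
  have hfeat : ∀ m : Measure (E d), IsFiniteMeasure m → Integrable (feature H φ) m := fun m _ =>
    integrable_of_bounded (continuous_feature hl hk hφ) (norm_feature_le hk hφ) m
  have hint : ∀ (m : Measure (E d)) (x : E d), IsFiniteMeasure m →
      Integrable (fun y : E d => φ (x - y)) m := fun m x _ =>
    Integrable.of_bound (by fun_prop) C (Eventually.of_forall fun y => hC _)
  have hprod : ∀ m : Measure (E d), IsFiniteMeasure m →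
      Integrable (fun p : E d × E d => φ (p.1 - p.2)) (volume.prod m) := by
    intro m hm
    rw [integrable_prod_iff' (by fun_prop)]
    refine ⟨Eventually.of_forall fun y => hφ.comp_sub_right y, ?_⟩
    have : ∀ y : E d, ∫ x, ‖φ (x - y)‖ = ∫ x, ‖φ x‖ := fun y =>
      integral_sub_right_eq_self (fun x => ‖φ x‖) y
    simp_rw [this]
    exact integrable_const _
  have hprodk : ∀ m : Measure (E d), IsFiniteMeasure m →
      Integrable (fun p : E d × E d => φ (p.1 - p.2) • (RKHS.kerFun H p.1 1 : H))
        (volume.prod m) := fun m hm =>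
    (hprod m hm).smul_bdd (√(lam 0)) (hkc.comp continuous_fst).aestronglyMeasurable
      (Eventually.of_forall fun p => norm_kerFun_one_le hk p.1)
  -- Symmetry of φ turns φ(x − t) into φ(t − x), so the substitution s = t − x yields the feature
  -- map; Fubini then moves the integral over μ outside.
  have hshift : ∀ t : E d, ∫ x, φ (x - t) • (RKHS.kerFun H x 1 : H) = feature H φ t := by
    intro t
    rw [feature, ← integral_sub_left_eq_self (fun s => φ s • (RKHS.kerFun H (t - s) 1 : H)) _ t]
    congr 1
    ext1 x
    rw [sub_sub_cancel, ← hp.symm (t - x), neg_sub]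
  have hmain : ∀ m : Measure (E d), IsFiniteMeasure m →
      ∫ x, (∫ y, φ (x - y) ∂m) • (RKHS.kerFun H x 1 : H) = ∫ t, feature H φ t ∂m := by
    intro m hm
    simp_rw [← integral_smul_const]
    rw [integral_integral_swap (hprodk m hm)]
    simp_rw [hshift]
  rw [embedConv, embed, integral_withDensityᵥ (integrable_convMeasure hp hd μ) hkc
    (norm_kerFun_one_le hk), integral_signed μ _ (hfeat _ inferInstance) (hfeat _ inferInstance),
    ← hmain _ inferInstance, ← hmain _ inferInstance, ← integral_sub]
  · congr 1
    ext1 x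
    rw [convMeasure, integral_signed μ _ (hint _ x inferInstance) (hint _ x inferInstance),
      sub_smul]
  · exact ((hprod _ inferInstance).integral_prod_left).smul_bdd (√(lam 0)) hkc.aestronglyMeasurable
      (Eventually.of_forall fun x => norm_kerFun_one_le hk x)
  · exact ((hprod _ inferInstance).integral_prod_left).smul_bdd (√(lam 0)) hkc.aestronglyMeasurable
      (Eventually.of_forall fun x => norm_kerFun_one_le hk x)

/-- `L ∘ Φ` as a linear map. -/
def embedConvₗ (hp : IsPosDefType φ) (hd : IsProbDensity φ) (hl : IsPosDefType lam)
    (hk : HasKernel H lam) : SignedMeasure (E d) →ₗ[ℝ] H where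
  toFun := embedConv H φ
  map_add' μ ν := by
    have h := fun ν : SignedMeasure (E d) => integrable_of_bounded
      (continuous_feature hl hk hd.integrable) (norm_feature_le hk hd.integrable)
      (VectorMeasure.variation ν)
    simp_rw [embedConv_eq_integral_feature hp hd hl hk]
    exact VectorMeasure.integral_add_vectorMeasure (h μ) (h ν)
  map_smul' a μ := by
    simp_rw [embedConv_eq_integral_feature hp hd hl hk]
    exact VectorMeasure.integral_smul_vectorMeasure _ a

theorem inner_embedConv (hp : IsPosDefType φ) (hd : IsProbDensity φ) (hl : IsPosDefType lam)
    (hk : HasKernel H lam) (c : H) (μ : SignedMeasure (E d)) :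
    inner ℝ c (embedConv H φ μ) = ∫ᵛ t, convFun φ c t ∂<•μ := by
  have hφ := hd.integrable
  have h := fun (m : Measure (E d)) (_ : IsFiniteMeasure m) => integrable_of_bounded
    (continuous_feature hl hk hφ) (norm_feature_le hk hφ) m
  have h' := fun (m : Measure (E d)) (_ : IsFiniteMeasure m) => integrable_of_bounded
    (continuous_convFun hl hk hφ c) (abs_convFun_le hl hk hφ c) m
  rw [embedConv_eq_integral_feature hp hd hl hk,
    integral_signed μ _ (h _ inferInstance) (h _ inferInstance),
    integral_signed μ _ (h' _ inferInstance) (h' _ inferInstance), inner_sub_right,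
    ← integral_inner (h _ inferInstance), ← integral_inner (h _ inferInstance)]
  simp_rw [inner_feature hl hk hφ]

end Feature

/-! ### Convex duality for least squares penalised by a seminorm. -/

section Duality

variable {V H : Type*} [AddCommGroup V] [Module ℝ V] [NormedAddCommGroup H]
  [InnerProductSpace ℝ H] (N : Seminorm ℝ V) (T : V →ₗ[ℝ] H) (f : H) (κ : ℝ)

/-- Least squares penalised by a seminorm. -/
def penalized (v : V) : ℝ := 1 / 2 * ‖f - T v‖ ^ 2 + κ * N v

/-- The Lagrangian of the penalised least squares program. -/
def penalizedLagrangian (c : H) (p : V × H) : ℝ :=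
  1 / 2 * ‖f - p.2‖ ^ 2 + κ * N p.1 - inner ℝ c (T p.1 - p.2)

variable {N T f κ}

/-- First-order optimality. Comparing v with (1 − t)v + tw and using convexity of N gives the
inequality up to an error t/2 ‖Tw − Tv‖², which is removed by taking t small. -/
theorem inner_sub_le_of_minimizer (hκ : 0 < κ) {v : V}
    (hv : ∀ w, penalized N T f κ v ≤ penalized N T f κ w) (w : V) :
    inner ℝ (f - T v) (T w - T v) ≤ κ * (N w - N v) := by
  set a := f - T v
  set b := T w - T v
  by_contra! hlt
  have key : ∀ t : ℝ, 0 < t → t ≤ 1 → inner ℝ a b - κ * (N w - N v) ≤ t / 2 * ‖b‖ ^ 2 := by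
    intro t ht ht1
    have h := hv ((1 - t) • v + t • w)
    have hT : f - T ((1 - t) • v + t • w) = a - t • b := by
      simp only [a, b, map_add, map_smul]
      module
    have hN : N ((1 - t) • v + t • w) ≤ (1 - t) * N v + t * N w := by
      refine (map_add_le_add N _ _).trans ?_
      rw [map_smul_eq_mul, map_smul_eq_mul, Real.norm_of_nonneg ht.le,
        Real.norm_of_nonneg (by linarith)]
    have hn : ‖a - t • b‖ ^ 2 = ‖a‖ ^ 2 - 2 * (t * inner ℝ a b) + t ^ 2 * ‖b‖ ^ 2 := by
      rw [norm_sub_sq_real, inner_smul_right, norm_smul, mul_pow, Real.norm_eq_abs, sq_abs]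
    simp only [penalized] at h
    rw [hT, hn] at h
    have h2 := mul_le_mul_of_nonneg_left hN hκ.le
    have h3 : t * (inner ℝ a b - κ * (N w - N v)) ≤ t * (t / 2 * ‖b‖ ^ 2) := by
      change 1 / 2 * ‖a‖ ^ 2 + _ ≤ _ at h
      linarith
    exact le_of_mul_le_mul_left h3 ht
  set δ := inner ℝ a b - κ * (N w - N v)
  have hδ : 0 < δ := by simp only [δ]; linarith
  have hb : 0 ≤ ‖b‖ ^ 2 := by positivity
  -- This t satisfies t(‖b‖² + 1) ≤ δ, which is incompatible with δ ≤ t/2 ‖b‖².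
  have h1 := key (min 1 (δ / (‖b‖ ^ 2 + 1))) (by positivity) (min_le_left _ _)
  have h2 : min 1 (δ / (‖b‖ ^ 2 + 1)) * (‖b‖ ^ 2 + 1) ≤ δ := by
    rw [← le_div_iff₀ (by positivity)]
    exact min_le_right _ _
  have h3 : 0 < min 1 (δ / (‖b‖ ^ 2 + 1)) := by positivity
  nlinarith

/-- The directions w = 0 and w = 2v are opposite seen from v, so the two inequalities combine to an
equality. -/
theorem inner_residual_self_of_minimizer (hκ : 0 < κ) {v : V}
    (hv : ∀ w, penalized N T f κ v ≤ penalized N T f κ w) :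
    inner ℝ (f - T v) (T v) = κ * N v := by
  have h0 := inner_sub_le_of_minimizer hκ hv 0
  have h2 := inner_sub_le_of_minimizer hκ hv ((2 : ℝ) • v)
  rw [map_zero, map_zero, zero_sub, inner_neg_right] at h0
  rw [map_smul, map_smul_eq_mul, two_smul, add_sub_cancel_right] at h2
  norm_num at h2
  linarith

theorem inner_residual_le_of_minimizer (hκ : 0 < κ) {v : V}
    (hv : ∀ w, penalized N T f κ v ≤ penalized N T f κ w) (w : V) :
    inner ℝ (f - T v) (T w) ≤ κ * N w := by
  have h := inner_sub_le_of_minimizer hκ hv w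
  rw [inner_sub_right, inner_residual_self_of_minimizer hκ hv] at h
  linarith

/-- Adding the optimality inequalities of v against w and of w against v cancels the seminorms and
leaves ‖Tw − Tv‖² ≤ 0. Equality of the optimal values then gives N v = N w. -/
theorem minimizer_unique (hκ : 0 < κ) {v w : V}
    (hv : ∀ u, penalized N T f κ v ≤ penalized N T f κ u)
    (hw : ∀ u, penalized N T f κ w ≤ penalized N T f κ u) : T v = T w ∧ N v = N w := by
  have h1 := inner_sub_le_of_minimizer hκ hv w
  have h2 := inner_sub_le_of_minimizer hκ hw v
  have h3 : inner ℝ (f - T v) (T w - T v) + inner ℝ (f - T w) (T v - T w)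
      = ‖T w - T v‖ ^ 2 := by
    rw [← real_inner_self_eq_norm_sq, ← neg_sub (T w) (T v), inner_neg_right, ← sub_eq_add_neg,
      ← inner_sub_left]
    congr 1
    abel
  have h4 : ‖T w - T v‖ ^ 2 ≤ 0 := by linarith
  have hT : T v = T w := by
    have := pow_eq_zero_iff (two_ne_zero) |>.1 (le_antisymm h4 (by positivity))
    rw [norm_eq_zero, sub_eq_zero] at this
    exact this.symm
  refine ⟨hT, ?_⟩
  have h5 := hv w
  have h6 := hw v
  simp only [penalized, hT] at h5 h6
  nlinarith

/-- The Lagrangian separates: feasibility makes the part in v nonnegative, hence minimal at 0, and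
completing the square in z puts the minimum at z = f − c. -/
theorem iInf_penalizedLagrangian_of_feasible {c : H} (hc : ∀ v, inner ℝ c (T v) ≤ κ * N v) :
    ⨅ p : V × H, (penalizedLagrangian N T f κ c p : EReal)
      = ((‖f‖ ^ 2 / 2 - 1 / 2 * ‖f - c‖ ^ 2 : ℝ) : EReal) := by
  have hexp : ‖f - c‖ ^ 2 = ‖f‖ ^ 2 - 2 * inner ℝ f c + ‖c‖ ^ 2 := norm_sub_sq_real f c
  apply le_antisymm
  · refine (iInf_le _ ((0 : V), f - c)).trans (EReal.coe_le_coe_iff.2 (le_of_eq ?_))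
    simp only [penalizedLagrangian, map_zero, sub_sub_cancel, zero_sub, mul_zero,
      inner_sub_right, real_inner_self_eq_norm_sq, neg_sub]
    rw [hexp, real_inner_comm]
    ring
  · refine le_iInf fun p => EReal.coe_le_coe_iff.2 ?_
    have h1 := hc p.1
    have h2 : 0 ≤ ‖f - p.2 - c‖ ^ 2 := by positivity
    rw [norm_sub_sq_real, inner_sub_left] at h2
    simp only [penalizedLagrangian, inner_sub_right]
    rw [hexp]
    have h3 := real_inner_comm c p.2
    linarith

/-- By homogeneity, large multiples of a violating v send the Lagrangian to −∞. -/
theorem iInf_penalizedLagrangian_of_not_feasible {c : H}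
    (hc : ¬ ∀ v, inner ℝ c (T v) ≤ κ * N v) :
    ⨅ p : V × H, (penalizedLagrangian N T f κ c p : EReal) = ⊥ := by
  push Not at hc
  obtain ⟨v, hv⟩ := hc
  rw [EReal.eq_bot_iff_forall_lt]
  intro y
  set δ := inner ℝ c (T v) - κ * N v
  have hδ : 0 < δ := by simp only [δ]; linarith
  obtain ⟨k, hk⟩ := exists_nat_gt ((1 / 2 * ‖f‖ ^ 2 - y) / δ)
  rw [div_lt_iff₀ hδ] at hk
  refine (iInf_le _ ((k : ℝ) • v, (0 : H))).trans_lt (EReal.coe_lt_coe_iff.2 ?_)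
  simp only [penalizedLagrangian, sub_zero, map_smul, map_smul_eq_mul, inner_smul_right,
    Real.norm_of_nonneg (Nat.cast_nonneg k)]
  have : (k : ℝ) * δ = k * inner ℝ c (T v) - k * (κ * N v) := by simp only [δ]; ring
  linarith

/-- The residual at a minimizer is the closest feasible point to the datum, strictly. -/
theorem norm_sub_sq_add_le_of_feasible (hκ : 0 < κ) {v : V}
    (hv : ∀ w, penalized N T f κ v ≤ penalized N T f κ w) {c : H}
    (hc : ∀ w, inner ℝ c (T w) ≤ κ * N w) :
    ‖f - (f - T v)‖ ^ 2 + ‖c - (f - T v)‖ ^ 2 ≤ ‖f - c‖ ^ 2 := by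
  have h1 := hc v
  -- This is the obtuse-angle condition ⟨c − (f − Tv), Tv⟩ ≤ 0 that characterises a projection.
  rw [← inner_residual_self_of_minimizer hκ hv] at h1
  have h2 : f - c = T v - (c - (f - T v)) := by abel
  have h3 := norm_sub_sq_real (T v) (c - (f - T v))
  rw [← h2, real_inner_comm, inner_sub_left] at h3
  rw [sub_sub_cancel]
  linarith

theorem penalized_minimizer_eq (hκ : 0 < κ) {v : V}
    (hv : ∀ w, penalized N T f κ v ≤ penalized N T f κ w) :
    penalized N T f κ v = ‖f‖ ^ 2 / 2 - 1 / 2 * ‖f - (f - T v)‖ ^ 2 := by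
  have h1 := inner_residual_self_of_minimizer hκ hv
  rw [penalized, ← h1, sub_sub_cancel, norm_sub_sq_real, inner_sub_left,
    real_inner_self_eq_norm_sq]
  ring

variable (N T κ) in
/-- The dual constraint: `c` is bounded by `κ * N` along `T`. -/
def DualBounded (c : H) : Prop := ∀ v, inner ℝ c (T v) ≤ κ * N v

variable (N T f κ) in
/-- The dual objective, the infimum of the Lagrangian. -/
def penalizedDual (c : H) : EReal := ⨅ p : V × H, (penalizedLagrangian N T f κ c p : EReal)

theorem iSup_penalizedDual (hκ : 0 < κ) {v : V}
    (hv : ∀ w, penalized N T f κ v ≤ penalized N T f κ w) :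
    ⨆ b, penalizedDual N T f κ b
      = ((‖f‖ ^ 2 / 2 - 1 / 2 * ‖f - (f - T v)‖ ^ 2 : ℝ) : EReal) := by
  refine le_antisymm (iSup_le fun b => ?_) ?_
  · by_cases hb : DualBounded N T κ b
    · rw [penalizedDual, iInf_penalizedLagrangian_of_feasible hb, EReal.coe_le_coe_iff]
      linarith [norm_sub_sq_add_le_of_feasible hκ hv hb, sq_nonneg ‖b - (f - T v)‖]
    · rw [penalizedDual, iInf_penalizedLagrangian_of_not_feasible hb]
      exact bot_le
  · rw [← iInf_penalizedLagrangian_of_feasible (inner_residual_le_of_minimizer hκ hv)]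
    exact le_iSup (penalizedDual N T f κ) (f - T v)

theorem iInf_norm_sub_sq_of_dualBounded (hκ : 0 < κ) {v : V}
    (hv : ∀ w, penalized N T f κ v ≤ penalized N T f κ w) {P : H → Prop}
    (hP : ∀ b, P b ↔ DualBounded N T κ b) :
    ⨅ b : {b : H // P b}, ((1 / 2 * ‖f - (b : H)‖ ^ 2 : ℝ) : EReal)
      = ((1 / 2 * ‖f - (f - T v)‖ ^ 2 : ℝ) : EReal) := by
  refine le_antisymm (iInf_le_of_le
    (⟨f - T v, (hP _).2 (inner_residual_le_of_minimizer hκ hv)⟩ : {b : H // P b}) le_rfl)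
    (le_iInf fun b => EReal.coe_le_coe_iff.2 ?_)
  linarith [norm_sub_sq_add_le_of_feasible hκ hv ((hP _).1 b.2), sq_nonneg ‖(b : H) - (f - T v)‖]

/-- Strong duality. -/
theorem iInf_penalized_eq_iSup_penalizedDual (hκ : 0 < κ) {v : V}
    (hv : ∀ w, penalized N T f κ v ≤ penalized N T f κ w) :
    ⨅ w, (penalized N T f κ w : EReal) = ⨆ b, penalizedDual N T f κ b := by
  rw [iSup_penalizedDual hκ hv, ← penalized_minimizer_eq hκ hv]
  exact le_antisymm (iInf_le _ v) (le_iInf fun w => EReal.coe_le_coe_iff.2 (hv w))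

/-- Uniqueness is quantitative: the dual objective at a feasible b falls short of the optimum by at
least half the squared distance from b to the residual. -/
theorem forall_penalizedDual_le_iff (hκ : 0 < κ) {v : V}
    (hv : ∀ w, penalized N T f κ v ≤ penalized N T f κ w) (b : H) :
    (∀ b', penalizedDual N T f κ b' ≤ penalizedDual N T f κ b) ↔ b = f - T v := by
  constructor
  · intro h
    have h1 := (iSup_le h).trans' (iSup_penalizedDual hκ hv).symm.le
    by_cases hb : DualBounded N T κ b
    · rw [penalizedDual, iInf_penalizedLagrangian_of_feasible hb, EReal.coe_le_coe_iff] at h1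
      have h2 : ‖b - (f - T v)‖ ^ 2 ≤ 0 := by
        linarith [norm_sub_sq_add_le_of_feasible hκ hv hb]
      have h3 := pow_eq_zero_iff two_ne_zero |>.1 (le_antisymm h2 (sq_nonneg _))
      rwa [norm_eq_zero, sub_eq_zero] at h3
    · rw [penalizedDual, iInf_penalizedLagrangian_of_not_feasible hb, le_bot_iff] at h1
      exact absurd h1 (EReal.coe_ne_bot _)
  · rintro rfl b'
    conv_rhs => rw [penalizedDual, iInf_penalizedLagrangian_of_feasible
      (inner_residual_le_of_minimizer hκ hv), ← iSup_penalizedDual hκ hv]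
    exact le_iSup _ b'

end Duality

/-! ### Vague compactness of bounded families of finite measures. -/

section VagueLimit
open scoped CompactlySupported

variable {X : Type*} [TopologicalSpace X] [MeasurableSpace X]

theorem _root_.Ultrafilter.exists_tendsto_of_abs_le {ι : Type*} (U : Ultrafilter ι) {u : ι → ℝ}
    {M : ℝ} (h : ∀ i, |u i| ≤ M) : ∃ a, Tendsto u U (𝓝 a) := by
  obtain ⟨a, -, ha⟩ := (isCompact_Icc (a := -M) (b := M)).ultrafilter_le_nhds (U.map u)
    (tendsto_principal.2 (Eventually.of_forall fun i => abs_le.1 (h i)) : Tendsto u U (𝓟 _))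
  exact ⟨a, ha⟩

/-- Along an ultrafilter every bounded real family converges, so all test functions are handled at
once without extracting subsequences. -/
theorem exists_tendsto_integral_compactlySupported {ι : Type*} (U : Ultrafilter ι)
    (m : ι → Measure X) [∀ i, IsFiniteMeasure (m i)] {M : ℝ} (hM : ∀ i, (m i).real Set.univ ≤ M)
    (f : C_c(X, ℝ)) : ∃ a, Tendsto (fun i => ∫ x, f x ∂m i) U (𝓝 a) := by
  obtain ⟨C, hC⟩ := f.hasCompactSupport.exists_bound_of_continuous f.continuous
  refine U.exists_tendsto_of_abs_le (M := max C 0 * M) fun i => ?_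
  have h := norm_integral_le_of_norm_le_const (μ := m i) (C := max C 0)
    (Eventually.of_forall fun x => (hC x).trans (le_max_left _ _))
  exact h.trans (by gcongr; exact hM i)

variable [BorelSpace X]

theorem integrable_compactlySupported (f : C_c(X, ℝ)) (m : Measure X) [IsFiniteMeasure m] :
    Integrable f m := by
  obtain ⟨C, hC⟩ := f.hasCompactSupport.exists_bound_of_continuous f.continuous
  exact Integrable.of_bound f.continuous.measurable.aestronglyMeasurable C (Eventually.of_forall hC)

/-- The vague limit of a bounded family of finite measures, as a positive functional. -/
def vagueLimit {ι : Type*} (U : Ultrafilter ι)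
    (m : ι → Measure X) [∀ i, IsFiniteMeasure (m i)] {M : ℝ}
    (hM : ∀ i, (m i).real Set.univ ≤ M) : C_c(X, ℝ) →ₚ[ℝ] ℝ :=
  PositiveLinearMap.mk₀
    { toFun := fun f => (exists_tendsto_integral_compactlySupported U m hM f).choose
      map_add' := fun f g => by
        refine tendsto_nhds_unique
          (exists_tendsto_integral_compactlySupported U m hM (f + g)).choose_spec ?_
        refine ((exists_tendsto_integral_compactlySupported U m hM f).choose_spec.add
          (exists_tendsto_integral_compactlySupported U m hM g).choose_spec).congr fun i => ?_
        rw [← integral_add (integrable_compactlySupported f _) (integrable_compactlySupported g _)]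
        rfl
      map_smul' := fun a f => by
        refine tendsto_nhds_unique
          (exists_tendsto_integral_compactlySupported U m hM (a • f)).choose_spec ?_
        refine ((exists_tendsto_integral_compactlySupported U m hM f).choose_spec.const_smul
          a).congr fun i => ?_
        rw [← integral_smul]
        rfl }
    (fun f hf => ge_of_tendsto
      (exists_tendsto_integral_compactlySupported U m hM f).choose_spec
      (Eventually.of_forall fun i => integral_nonneg fun x => hf x))

theorem tendsto_vagueLimit {ι : Type*} (U : Ultrafilter ι)
    (m : ι → Measure X) [∀ i, IsFiniteMeasure (m i)] {M : ℝ}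
    (hM : ∀ i, (m i).real Set.univ ≤ M) (f : C_c(X, ℝ)) :
    Tendsto (fun i => ∫ x, f x ∂m i) U (𝓝 (vagueLimit U m hM f)) :=
  (exists_tendsto_integral_compactlySupported U m hM f).choose_spec

/-- Bounded sets of finite measures are relatively compact for the topology of integration of
functions that vanish at infinity. -/
theorem exists_measure_tendsto_integral [T2Space X] [LocallyCompactSpace X] [SigmaCompactSpace X]
    {ι : Type*} (U : Ultrafilter ι)
    (m : ι → Measure X) [∀ i, IsFiniteMeasure (m i)] {a : ℝ} {M : ℝ}
    (hM : ∀ i, (m i).real Set.univ ≤ M) (ha : Tendsto (fun i => (m i).real Set.univ) U (𝓝 a)) :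
    ∃ ν : Measure X, IsFiniteMeasure ν ∧ ν.real Set.univ ≤ a ∧
      ∀ g : X → ℝ, Continuous g → Tendsto g (cocompact X) (𝓝 0) →
        Tendsto (fun i => ∫ x, g x ∂m i) U (𝓝 (∫ x, g x ∂ν)) := by
  have ha0 : 0 ≤ a := ge_of_tendsto' ha fun i => measureReal_nonneg
  have hM0 : 0 ≤ M := by
    obtain ⟨i, -⟩ := U.nonempty_of_mem univ_mem
    exact measureReal_nonneg.trans (hM i)
  set Λ := vagueLimit U m hM
  set ν := RealRMK.rieszMeasure Λ
  have hcut : ∀ K : Set X, IsCompact K → ∃ h : C_c(X, ℝ), (∀ x ∈ K, h x = 1) ∧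
      ∀ x, 0 ≤ h x ∧ h x ≤ 1 := by
    intro K hK
    obtain ⟨h, h1, -, hs, hI⟩ := exists_continuous_one_zero_of_isCompact hK isClosed_empty
      (Set.disjoint_empty K)
    exact ⟨⟨h, hs⟩, fun x hx => h1 hx, fun x => hI x⟩
  -- Mass may escape to infinity, so only an upper bound on the limit mass is available; it is
  -- obtained on compact sets and exhausted.
  have hK : ∀ K : Set X, IsCompact K → ν K ≤ ENNReal.ofReal a := by
    intro K hK
    obtain ⟨h, h1, hI⟩ := hcut K hK
    refine (RealRMK.rieszMeasure_le_of_eq_one Λ (fun x => (hI x).1) hK h1).trans ?_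
    refine ENNReal.ofReal_le_ofReal (le_of_tendsto_of_tendsto' (tendsto_vagueLimit U m hM h) ha
      fun i => ?_)
    have := integral_mono (μ := m i) (integrable_compactlySupported h _) (integrable_const 1)
      fun x => (hI x).2
    simpa using this
  have huniv : ν Set.univ ≤ ENNReal.ofReal a := by
    rw [← iUnion_compactCovering X, Monotone.measure_iUnion (fun i j hij =>
      compactCovering_subset X hij)]
    exact iSup_le fun n => hK _ (isCompact_compactCovering X n)
  have hfin : IsFiniteMeasure ν := ⟨huniv.trans_lt ENNReal.ofReal_lt_top⟩
  have hreal : ν.real Set.univ ≤ a := by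
    rw [measureReal_def]
    exact ENNReal.toReal_le_of_le_ofReal ha0 huniv
  refine ⟨ν, hfin, hreal, fun g hg hg0 => ?_⟩
  rw [Metric.tendsto_nhds]
  intro ε hε
  -- Cutting g off costs at most δM for the family and δa for the limit, together less than ε/2; the
  -- rest of ε is for the convergence of the cut-off integrals.
  set δ := ε / (2 * (M + a + 1)) with hδ
  have hδ0 : 0 < δ := by positivity
  obtain ⟨K, hKc, hKg⟩ := mem_cocompact.1 (Metric.tendsto_nhds.1 hg0 δ hδ0)
  obtain ⟨h, h1, hI⟩ := hcut K hKc
  let gh : C_c(X, ℝ) := ⟨⟨fun x => g x * h x, hg.mul h.continuous⟩,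
    h.hasCompactSupport.mul_left⟩
  have hgh : ∀ x, gh x = g x * h x := fun x => rfl
  have hclose : ∀ x, |g x - gh x| ≤ δ := by
    intro x
    by_cases hx : x ∈ K
    · simp [hgh, h1 x hx, hδ0.le]
    · have h2 : |g x| < δ := by simpa using hKg hx
      have h3 : g x - gh x = g x * (1 - h x) := by rw [hgh]; ring
      rw [h3, abs_mul, abs_of_nonneg (sub_nonneg.2 (hI x).2)]
      have := (hI x).1
      nlinarith [abs_nonneg (g x)]
  have hgi : ∀ p : Measure X, IsFiniteMeasure p → Integrable g p := by
    intro p _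
    have h2 : Integrable (fun x => g x - gh x) p := by
      refine Integrable.of_bound ?_ δ (Eventually.of_forall hclose)
      exact (hg.sub gh.continuous).measurable.aestronglyMeasurable
    refine (h2.add (integrable_compactlySupported gh p)).congr
      (Eventually.of_forall fun x => by simp)
  have hdiff : ∀ (p : Measure X), IsFiniteMeasure p →
      |∫ x, g x ∂p - ∫ x, gh x ∂p| ≤ δ * p.real Set.univ := by
    intro p hp
    rw [← integral_sub (hgi p hp) (integrable_compactlySupported gh p)]
    exact norm_integral_le_of_norm_le_const (f := fun x => g x - gh x)
      (Eventually.of_forall hclose)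
  have hlim := tendsto_vagueLimit U m hM gh
  rw [← RealRMK.integral_rieszMeasure] at hlim
  filter_upwards [Metric.tendsto_nhds.1 hlim (ε / 2) (by positivity)] with i hi
  rw [Real.dist_eq] at hi ⊢
  have e1 := hdiff (m i) inferInstance
  have e2 := hdiff ν hfin
  have e3 : δ * (m i).real Set.univ ≤ δ * M := by gcongr; exact hM i
  have e4 : δ * ν.real Set.univ ≤ δ * a := by gcongr
  have e5 : δ * M + δ * a < ε / 2 := by
    have : δ * (M + a + 1) = ε / 2 := by rw [hδ]; field_simp
    nlinarith
  rw [abs_lt] at hi ⊢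
  rw [abs_le] at e1 e2
  constructor <;> linarith

end VagueLimit

/-! ### Existence of a primal solution. -/

section Existence

variable {d : ℕ} {φ lam : E d → ℝ} {H : Type*} [NormedAddCommGroup H] [InnerProductSpace ℝ H]
  [CompleteSpace H] [RKHS ℝ H (E d) ℝ]

/-- Jordan parts are treated separately. Their limits need not be mutually singular, which is a
further reason why the norm bound is only an inequality. -/
theorem exists_signedMeasure_tendsto_integral {ι : Type*} (U : Ultrafilter ι)
    (μ : ι → SignedMeasure (E d)) {M : ℝ} (hM : ∀ i, tvNorm (μ i) ≤ M) :
    ∃ (ν : SignedMeasure (E d)) (a : ℝ), Tendsto (fun i => tvNorm (μ i)) U (𝓝 a) ∧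
      tvNorm ν ≤ a ∧ ∀ g : E d → ℝ, Continuous g → Tendsto g (cocompact (E d)) (𝓝 0) →
        Tendsto (fun i => ∫ᵛ x, g x ∂<•(μ i)) U (𝓝 (∫ᵛ x, g x ∂<•ν)) := by
  have hMp : ∀ i, (μ i).toJordanDecomposition.posPart.real Set.univ ≤ M := fun i => by
    have := hM i
    rw [tvNorm_eq_posPart_add_negPart] at this
    linarith [measureReal_nonneg (μ := (μ i).toJordanDecomposition.negPart) (s := Set.univ)]
  have hMn : ∀ i, (μ i).toJordanDecomposition.negPart.real Set.univ ≤ M := fun i => by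
    have := hM i
    rw [tvNorm_eq_posPart_add_negPart] at this
    linarith [measureReal_nonneg (μ := (μ i).toJordanDecomposition.posPart) (s := Set.univ)]
  obtain ⟨a, ha⟩ := U.exists_tendsto_of_abs_le
    (fun i => (abs_of_nonneg measureReal_nonneg).trans_le (hMp i))
  obtain ⟨b, hb⟩ := U.exists_tendsto_of_abs_le
    (fun i => (abs_of_nonneg measureReal_nonneg).trans_le (hMn i))
  obtain ⟨p, hp, hpa, hpg⟩ := exists_measure_tendsto_integral U _ hMp ha
  obtain ⟨q, hq, hqb, hqg⟩ := exists_measure_tendsto_integral U _ hMn hb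
  refine ⟨p.toSignedMeasure - q.toSignedMeasure, a + b, ?_, ?_, fun g hg hg0 => ?_⟩
  · simp_rw [tvNorm_eq_posPart_add_negPart]
    exact ha.add hb
  · exact (tvNorm_sub_toSignedMeasure_le p q).trans (add_le_add hpa hqb)
  · let g0 : ZeroAtInftyContinuousMap (E d) ℝ := ⟨⟨g, hg⟩, hg0⟩
    have hgb : ∀ x, ‖g x‖ ≤ ‖g0.toBCF‖ := fun x => g0.toBCF.norm_coe_le_norm x
    rw [integral_sub_toSignedMeasure (integrable_of_bounded hg hgb _)
      (integrable_of_bounded hg hgb _)]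
    refine ((hpg g hg hg0).sub (hqg g hg hg0)).congr fun i => ?_
    rw [integral_signed (μ i) g (integrable_of_bounded hg hgb _)
      (integrable_of_bounded hg hgb _)]

theorem primalObj_nonneg {κ : ℝ} (hκ : 0 < κ) {n : ℕ} (X : Fin n → E d)
    (μ : SignedMeasure (E d)) : 0 ≤ primalObj H φ κ X μ := by
  have : 0 ≤ tvNorm μ := measureReal_nonneg
  unfold primalObj
  positivity

theorem exists_isPrimalSol (hp : IsPosDefType φ) (hd : IsProbDensity φ) (hl : IsPosDefType lam)
    (h0 : Tendsto lam (cocompact (E d)) (𝓝 0)) (hk : HasKernel H lam) {κ : ℝ} (hκ : 0 < κ)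
    {n : ℕ} (X : Fin n → E d) : ∃ μ, IsPrimalSol H φ κ X μ := by
  set P := primalObj H φ κ X with hP
  have hbdd : BddBelow (Set.range P) := ⟨0, by
    rintro _ ⟨μ, rfl⟩
    exact primalObj_nonneg hκ X μ⟩
  obtain ⟨u, -, hu, hmem⟩ := exists_seq_tendsto_sInf (Set.range_nonempty P) hbdd
  choose μ hμ using hmem
  obtain ⟨C, hC⟩ := hu.bddAbove_range
  set f := embed H (empirical X)
  have hM : ∀ i, tvNorm (μ i) ≤ C / κ := by
    intro i
    have h1 : P (μ i) ≤ C := by rw [hμ]; exact hC ⟨i, rfl⟩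
    have h2 : κ * tvNorm (μ i) ≤ P (μ i) := by
      simp only [hP, primalObj]
      linarith [sq_nonneg ‖embed H (empirical X) - embedConv H φ (μ i)‖]
    rw [le_div_iff₀ hκ]
    linarith
  obtain ⟨ν, a, ha, hνa, hg⟩ := exists_signedMeasure_tendsto_integral (hyperfilter ℕ) μ hM
  have hPlim : Tendsto (fun i => P (μ i)) (hyperfilter ℕ) (𝓝 (sInf (Set.range P))) := by
    simp_rw [hμ]
    exact hu.mono_left Nat.hyperfilter_le_atTop
  set w := f - embedConv H φ ν with hw
  have hφ := hd.integrable
  have hinner : Tendsto (fun i => (inner ℝ w (embedConv H φ (μ i)) : ℝ)) (hyperfilter ℕ)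
      (𝓝 (inner ℝ w (embedConv H φ ν))) := by
    simp_rw [inner_embedConv hp hd hl hk]
    exact hg _ (continuous_convFun hl hk hφ w) (tendsto_convFun_cocompact hl hk h0 hφ w)
  -- Lower semicontinuity by ½‖v‖² ≥ ⟨w, v⟩ − ½‖w‖² with w the residual at the limit: only the
  -- pairing with this fixed w has to converge.
  have hlow : Tendsto (fun i => inner ℝ w f - inner ℝ w (embedConv H φ (μ i))
      - 1 / 2 * ‖w‖ ^ 2 + κ * tvNorm (μ i)) (hyperfilter ℕ)
      (𝓝 (inner ℝ w f - inner ℝ w (embedConv H φ ν) - 1 / 2 * ‖w‖ ^ 2 + κ * a)) :=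
    ((hinner.const_sub _).sub_const _).add (ha.const_mul κ)
  have hle := le_of_tendsto_of_tendsto' hlow hPlim fun i => by
    have h1 : 0 ≤ ‖w - (f - embedConv H φ (μ i))‖ ^ 2 := by positivity
    rw [norm_sub_sq_real, inner_sub_right] at h1
    simp only [hP, primalObj]
    change _ ≤ 1 / 2 * ‖f - embedConv H φ (μ i)‖ ^ 2 + _
    linarith
  rw [← inner_sub_right, ← hw, real_inner_self_eq_norm_sq] at hle
  refine ⟨ν, fun ρ => ?_⟩
  have h1 : sInf (Set.range P) ≤ P ρ := csInf_le hbdd ⟨ρ, rfl⟩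
  have h2 := mul_le_mul_of_nonneg_left hνa hκ.le
  change 1 / 2 * ‖w‖ ^ 2 + κ * tvNorm ν ≤ P ρ
  linarith

end Existence

/-! ### Entire extensions of Fourier transforms and their decay. -/

section PaleyWiener
open scoped ContDiff FourierTransform

/-- The entire extension of the inverse Fourier transform of a compactly supported function. -/
def entireFourier (χ : ℝ → ℂ) (w : ℂ) : ℂ :=
  ∫ v : ℝ, Complex.exp (2 * Real.pi * Complex.I * v * w) * χ v

theorem norm_exp_two_pi (v : ℝ) (w : ℂ) :
    ‖Complex.exp (2 * Real.pi * Complex.I * v * w)‖ = Real.exp (-(2 * Real.pi * v * w.im)) := by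
  rw [Complex.norm_exp]
  congr 1
  simp

theorem integrable_exp_mul {χ : ℝ → ℂ} (hc : Continuous χ) (hs : HasCompactSupport χ) (w : ℂ) :
    Integrable fun v : ℝ => Complex.exp (2 * Real.pi * Complex.I * v * w) * χ v :=
  Continuous.integrable_of_hasCompactSupport (by fun_prop) hs.mul_left

theorem exists_norm_entireFourier_le {χ : ℝ → ℂ} (hc : Continuous χ) (hs : HasCompactSupport χ) :
    ∃ C R : ℝ, 0 ≤ C ∧ 0 ≤ R ∧ ∀ w, ‖entireFourier χ w‖ ≤ C * Real.exp (R * |w.im|) := by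
  obtain ⟨R, hR0, hR⟩ := hs.isCompact.isBounded.exists_pos_norm_le
  refine ⟨∫ v, ‖χ v‖, 2 * Real.pi * R, by positivity, by positivity, fun w => ?_⟩
  rw [← integral_mul_const]
  refine norm_integral_le_of_norm_le
    ((hc.integrable_of_hasCompactSupport hs).norm.mul_const _) (Eventually.of_forall fun v => ?_)
  rw [norm_mul, norm_exp_two_pi, mul_comm]
  by_cases hv : v ∈ tsupport χ
  · gcongr
    have h1 := hR v hv
    rw [Real.norm_eq_abs] at h1
    calc -(2 * Real.pi * v * w.im) ≤ |2 * Real.pi * v * w.im| := neg_le_abs _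
      _ = 2 * Real.pi * |v| * |w.im| := by
        rw [abs_mul, abs_mul, abs_of_pos Real.two_pi_pos]
      _ ≤ _ := by gcongr
  · simp [image_eq_zero_of_notMem_tsupport hv]

theorem entireFourier_deriv {χ : ℝ → ℂ} (hc : ContDiff ℝ 1 χ) (hs : HasCompactSupport χ) (w : ℂ) :
    entireFourier (deriv χ) w = -(2 * Real.pi * Complex.I * w * entireFourier χ w) := by
  have hd : Continuous (deriv χ) := hc.continuous_deriv le_rfl
  have he : ∀ v : ℝ, HasDerivAt (fun v : ℝ => Complex.exp (2 * Real.pi * Complex.I * v * w))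
      (2 * Real.pi * Complex.I * w * Complex.exp (2 * Real.pi * Complex.I * v * w)) v := by
    intro v
    have h1 : HasDerivAt (fun v : ℝ => 2 * Real.pi * Complex.I * (v : ℂ) * w)
        (2 * Real.pi * Complex.I * 1 * w) v :=
      ((Complex.ofRealCLM.hasDerivAt (x := v)).const_mul _).mul_const _
    convert h1.cexp using 1
    ring
  have h := integral_mul_deriv_eq_deriv_mul_of_integrable
    (u := fun v : ℝ => Complex.exp (2 * Real.pi * Complex.I * v * w)) (v := χ)
    (fun v _ => he v) (fun v _ => (hc.differentiable one_ne_zero v).hasDerivAt)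
    (integrable_exp_mul hd hs.deriv w)
    (((integrable_exp_mul hc.continuous hs w).const_mul (2 * Real.pi * Complex.I * w)).congr
      (Eventually.of_forall fun v => by simp only [Pi.mul_apply]; ring))
    (integrable_exp_mul hc.continuous hs w)
  rw [entireFourier, h, entireFourier, ← integral_const_mul]
  congr 2
  ext v
  ring

/-- Two integrations by parts trade a factor w² for χ'', which is again compactly supported. The
resulting decay is integrable on horizontal lines. -/
theorem exists_entireFourier_decay {χ : ℝ → ℂ} (hc : ContDiff ℝ ∞ χ) (hs : HasCompactSupport χ) :
    ∃ C R : ℝ, 0 ≤ C ∧ 0 ≤ R ∧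
      ∀ w, ‖entireFourier χ w‖ * (1 + ‖w‖ ^ 2) ≤ C * Real.exp (R * |w.im|) := by
  have hc1 : ContDiff ℝ 1 χ := hc.of_le (by exact_mod_cast le_top)
  have hd : ContDiff ℝ ∞ (deriv χ) := (contDiff_infty_iff_deriv.1 hc).2
  have hd1 : ContDiff ℝ 1 (deriv χ) := hd.of_le (by exact_mod_cast le_top)
  obtain ⟨C₁, R₁, hC₁, hR₁, h₁⟩ := exists_norm_entireFourier_le hc.continuous hs
  obtain ⟨C₂, R₂, hC₂, hR₂, h₂⟩ := exists_norm_entireFourier_le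
    (hd1.continuous_deriv le_rfl) hs.deriv.deriv
  refine ⟨C₁ + C₂, R₁ + R₂, by positivity, by positivity, fun w => ?_⟩
  have h3 := h₂ w
  rw [entireFourier_deriv hd1 hs.deriv, entireFourier_deriv hc1 hs] at h3
  have h4 : ‖-(2 * Real.pi * Complex.I * w * -(2 * Real.pi * Complex.I * w * entireFourier χ w))‖
      = (2 * Real.pi) ^ 2 * (‖w‖ ^ 2 * ‖entireFourier χ w‖) := by
    simp only [norm_neg, norm_mul, Complex.norm_I, Complex.norm_real, Real.norm_eq_abs,
      abs_of_pos Real.pi_pos, Complex.norm_ofNat]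
    ring
  rw [h4] at h3
  have h5 : 1 ≤ (2 * Real.pi) ^ 2 := by nlinarith [Real.pi_gt_three]
  have h6 : ‖w‖ ^ 2 * ‖entireFourier χ w‖ ≤ (2 * Real.pi) ^ 2 * (‖w‖ ^ 2 * ‖entireFourier χ w‖) :=
    le_mul_of_one_le_left (by positivity) h5
  have h7 : C₁ * Real.exp (R₁ * |w.im|) ≤ C₁ * Real.exp ((R₁ + R₂) * |w.im|) := by
    gcongr; linarith
  have h8 : C₂ * Real.exp (R₂ * |w.im|) ≤ C₂ * Real.exp ((R₁ + R₂) * |w.im|) := by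
    gcongr; linarith
  linarith [h₁ w]

/-- The derivative is again an `entireFourier`, so the decay estimate also serves to dominate
derivatives. -/
theorem hasDerivAt_entireFourier {χ : ℝ → ℂ} (hc : Continuous χ) (hs : HasCompactSupport χ)
    (w : ℂ) : HasDerivAt (entireFourier χ)
      (entireFourier (fun v => 2 * Real.pi * Complex.I * v * χ v) w) w := by
  have hbound : Integrable fun v : ℝ =>
      Real.exp (2 * Real.pi * |v| * (‖w‖ + 1)) * ‖2 * Real.pi * Complex.I * v * χ v‖ := by
    refine Continuous.integrable_of_hasCompactSupport (by fun_prop) ?_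
    exact (hs.mul_left (f := fun v : ℝ => 2 * Real.pi * Complex.I * v)).norm.mul_left
  refine (hasDerivAt_integral_of_dominated_loc_of_deriv_le (Metric.ball_mem_nhds w one_pos)
    (F' := fun z v => Complex.exp (2 * Real.pi * Complex.I * v * z)
      * (2 * Real.pi * Complex.I * v * χ v))
    (Eventually.of_forall fun z => (integrable_exp_mul hc hs z).aestronglyMeasurable)
    (integrable_exp_mul hc hs w)
    ((by fun_prop : Continuous _).aestronglyMeasurable) (Eventually.of_forall fun v z hz => ?_)
    hbound (Eventually.of_forall fun v z _ => ?_)).2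
  · rw [norm_mul, norm_exp_two_pi]
    gcongr
    have h1 : ‖z‖ ≤ ‖w‖ + 1 := by
      have := norm_le_norm_add_norm_sub' z w
      rw [Metric.mem_ball, dist_eq_norm] at hz
      linarith
    calc -(2 * Real.pi * v * z.im) ≤ |2 * Real.pi * v * z.im| := neg_le_abs _
      _ = 2 * Real.pi * |v| * |z.im| := by
        rw [abs_mul, abs_mul, abs_of_pos Real.two_pi_pos]
      _ ≤ _ := by
        gcongr
        exact (Complex.abs_im_le_norm z).trans h1
  · have h1 : HasDerivAt (fun z : ℂ => 2 * Real.pi * Complex.I * (v : ℂ) * z)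
        (2 * Real.pi * Complex.I * v * 1) z := (hasDerivAt_id z).const_mul _
    exact (h1.cexp.mul_const (χ v)).congr_deriv (by ring)

theorem continuous_entireFourier {χ : ℝ → ℂ} (hc : Continuous χ) (hs : HasCompactSupport χ) :
    Continuous (entireFourier χ) :=
  continuous_iff_continuousAt.2 fun w => (hasDerivAt_entireFourier hc hs w).continuousAt

theorem exists_entireFourier_sub_le {χ : ℝ → ℂ} (hc : ContDiff ℝ ∞ χ) (hs : HasCompactSupport χ)
    (w : ℂ) : ∃ C : ℝ, 0 ≤ C ∧ ∀ z ∈ Metric.ball w 1, ∀ t : ℝ,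
      ‖entireFourier χ (z - t)‖ ≤ C * (1 + (w.re - t) ^ 2)⁻¹ := by
  obtain ⟨C, R, hC, hR, h⟩ := exists_entireFourier_decay hc hs
  refine ⟨3 * (C * Real.exp (R * (|w.im| + 1))), by positivity, fun z hz t => ?_⟩
  rw [Metric.mem_ball, dist_eq_norm] at hz
  rw [← div_eq_mul_inv, le_div_iff₀ (by positivity)]
  have him : |(z - t).im| ≤ |w.im| + 1 := by
    have h1 : (z - t).im = w.im + (z - w).im := by simp
    rw [h1]
    exact (abs_add_le _ _).trans (by gcongr; exact (Complex.abs_im_le_norm _).trans hz.le)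
  have hre : |w.re - t| ≤ ‖z - t‖ + 1 := by
    have h1 : w.re - t = (z - t - (z - w)).re := by simp
    rw [h1]
    exact (Complex.abs_re_le_norm _).trans ((norm_sub_le _ _).trans (by gcongr))
  -- Follows from 1 + (r + 1)² ≤ 3(1 + r²) with r = ‖z − t‖.
  have hsq : 1 + (w.re - t) ^ 2 ≤ 3 * (1 + ‖z - t‖ ^ 2) := by
    rw [← sq_abs (w.re - t)]
    nlinarith [sq_nonneg (‖z - t‖ - 1), abs_nonneg (w.re - t), norm_nonneg (z - t)]
  calc ‖entireFourier χ (z - t)‖ * (1 + (w.re - t) ^ 2)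
      ≤ ‖entireFourier χ (z - t)‖ * (3 * (1 + ‖z - t‖ ^ 2)) := by gcongr
    _ = 3 * (‖entireFourier χ (z - t)‖ * (1 + ‖z - t‖ ^ 2)) := by ring
    _ ≤ 3 * (C * Real.exp (R * |(z - t).im|)) :=
        mul_le_mul_of_nonneg_left (h _) (by norm_num)
    _ ≤ _ := by gcongr

theorem integrable_entireFourier_ofReal {χ : ℝ → ℂ} (hc : ContDiff ℝ ∞ χ)
    (hs : HasCompactSupport χ) : Integrable fun t : ℝ => entireFourier χ t := by
  obtain ⟨C, R, hC, hR, h⟩ := exists_entireFourier_decay hc hs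
  have hcont := (continuous_entireFourier hc.continuous hs).comp Complex.continuous_ofReal
  refine (integrable_inv_one_add_sq.const_mul C).mono' hcont.aestronglyMeasurable
    (Eventually.of_forall fun t => ?_)
  have := h t
  rw [← div_eq_mul_inv, le_div_iff₀ (by positivity)]
  simpa using this

/-- Convolution of a bounded function with a band-limited smooth kernel is entire. -/
theorem differentiable_convolution_entireFourier {χ : ℝ → ℂ} (hc : ContDiff ℝ ∞ χ)
    (hs : HasCompactSupport χ) {u : ℝ → ℝ} (hu : Continuous u) {M : ℝ} (hM : ∀ t, |u t| ≤ M) :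
    Differentiable ℂ fun z : ℂ => ∫ t : ℝ, entireFourier χ (z - t) * u t := by
  intro w
  set χ' : ℝ → ℂ := fun v => 2 * Real.pi * Complex.I * v * χ v
  have hc' : ContDiff ℝ ∞ χ' :=
    (contDiff_const.mul Complex.ofRealCLM.contDiff).mul hc
  have hs' : HasCompactSupport χ' := hs.mul_left
  have hM0 : 0 ≤ M := (abs_nonneg _).trans (hM 0)
  obtain ⟨C, hC0, hC⟩ := exists_entireFourier_sub_le hc hs w
  obtain ⟨C', hC0', hC'⟩ := exists_entireFourier_sub_le hc' hs' w
  have hk := continuous_entireFourier hc.continuous hs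
  have hk' := continuous_entireFourier hc'.continuous hs'
  have hdom : ∀ D : ℝ, Integrable fun t : ℝ => D * (1 + (w.re - t) ^ 2)⁻¹ * M := fun D =>
    ((integrable_inv_one_add_sq.comp_sub_left w.re).const_mul D).mul_const M
  have hmeas : ∀ z : ℂ, AEStronglyMeasurable (fun t : ℝ => entireFourier χ (z - t) * u t) :=
    fun z => ((hk.comp (by fun_prop)).mul (Complex.continuous_ofReal.comp hu)).aestronglyMeasurable
  refine ((hasDerivAt_integral_of_dominated_loc_of_deriv_le (Metric.ball_mem_nhds w one_pos)
    (F' := fun z (t : ℝ) => entireFourier χ' (z - t) * u t)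
    (Eventually.of_forall hmeas) ((hdom C).mono' (hmeas w) (Eventually.of_forall fun t => ?_))
    ((hk'.comp (by fun_prop)).mul (Complex.continuous_ofReal.comp hu)).aestronglyMeasurable
    (Eventually.of_forall fun t z hz => ?_) (hdom C')
    (Eventually.of_forall fun t z _ => ?_)).2).differentiableAt
  · rw [norm_mul, Complex.norm_real]
    gcongr
    · exact hC w (Metric.mem_ball_self one_pos) t
    · exact hM t
  · rw [norm_mul, Complex.norm_real]
    gcongr
    · exact hC' z hz t
    · exact hM t
  · have h1 := (hasDerivAt_entireFourier hc.continuous hs (z - t)).comp z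
      ((hasDerivAt_id z).sub_const (t : ℂ))
    simpa using h1.mul_const (u t : ℂ)

/-- The reproducing identity exhibits u as the real part, on the real line, of an entire function.
-/
theorem analyticOnNhd_of_eq_convolution {χ : ℝ → ℂ} (hc : ContDiff ℝ ∞ χ)
    (hs : HasCompactSupport χ) {u : ℝ → ℝ} (hu : Continuous u) {M : ℝ} (hM : ∀ t, |u t| ≤ M)
    (h : ∀ x, ∫ t : ℝ, (entireFourier χ t).re * u (x - t) = u x) :
    AnalyticOnNhd ℝ u Set.univ := by
  set F : ℂ → ℂ := fun z => ∫ t : ℝ, entireFourier χ (z - t) * u t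
  have hF := differentiable_convolution_entireFourier hc hs hu hM
  have hueq : u = fun x : ℝ => (F x).re := by
    ext x
    rw [← h x, ← integral_sub_left_eq_self _ _ x]
    simp only [F, sub_sub_cancel]
    have hint : Integrable fun t : ℝ => entireFourier χ ((x : ℂ) - t) * u t := by
      have h1 := (integrable_entireFourier_ofReal hc hs).comp_sub_left x
      refine (h1.mul_bdd (c := M) (Complex.continuous_ofReal.comp hu).aestronglyMeasurable
        (Eventually.of_forall fun t => ?_)).congr (Eventually.of_forall fun t => ?_)
      · simpa using hM t
      · simp
    refine Eq.trans ?_ (Complex.reCLM.integral_comp_comm hint)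
    congr 1
    ext t
    simp
  rw [hueq]
  intro x _
  have h1 : AnalyticAt ℝ F (x : ℂ) := (hF.analyticAt x).restrictScalars
  have h2 : AnalyticAt ℝ (fun x : ℝ => F x) x :=
    h1.comp (Complex.ofRealCLM.analyticAt x)
  exact (Complex.reCLM.analyticAt _).comp h2

end PaleyWiener

/-! ### Bounded spectrum, analyticity and discreteness in dimension one. -/

section BandLimited
open scoped ContDiff FourierTransform

theorem entireFourier_ofReal (χ : ℝ → ℂ) (t : ℝ) : entireFourier χ t = 𝓕⁻ χ t := by
  rw [Real.fourierInv_eq', entireFourier]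
  congr 1
  ext v
  simp only [smul_eq_mul, RCLike.inner_apply, conj_trivial]
  congr 2
  push_cast
  ring

/-- Fourier inversion for smooth compactly supported functions. -/
theorem integral_entireFourier_mul_exp {χ : ℝ → ℂ} (hc : ContDiff ℝ ∞ χ)
    (hs : HasCompactSupport χ) (a : ℝ) :
    ∫ t : ℝ, entireFourier χ t * Complex.exp (-(t * a * Complex.I)) = χ (a / (2 * Real.pi)) := by
  let S : SchwartzMap ℝ ℂ := hs.toSchwartzMap hc
  have h : 𝓕 (𝓕⁻ S) (a / (2 * Real.pi)) = χ (a / (2 * Real.pi)) := by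
    rw [FourierTransform.fourier_fourierInv_eq]
    rfl
  rw [← h, SchwartzMap.fourier_coe, SchwartzMap.fourierInv_coe,
    Real.fourier_real_eq_integral_exp_smul]
  congr 1
  ext t
  rw [smul_eq_mul, mul_comm, entireFourier_ofReal]
  congr 2
  push_cast
  field_simp

/-- The isometry between the line and the one-dimensional Euclidean space. -/
def lineEquiv : ℝ ≃ₗᵢ[ℝ] E 1 := (OrthonormalBasis.singleton (Fin 1) ℝ).repr

/-- f superposes characters with frequencies in the support of its spectral measure. Convolution
with the transform of χ multiplies the character of frequency ξ by χ(ξ/2π), and χ is 1 at all those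
points. -/
theorem exists_reproducing_kernel {f : E 1 → ℝ} (hf : HasBoundedSpectrum f) :
    ∃ χ : ℝ → ℂ, ContDiff ℝ ∞ χ ∧ HasCompactSupport χ ∧
      ∀ y, ∫ t : ℝ, (entireFourier χ t).re * f (y - lineEquiv t) = f y := by
  obtain ⟨Λ, ⟨hΛ, hfΛ⟩, hb⟩ := hf
  obtain ⟨R, hR0, hR⟩ := hb.exists_pos_norm_le
  -- Radius R suffices, because dividing a frequency by 2π only shrinks it.
  let b : ContDiffBump (0 : ℝ) := ⟨R, R + 1, hR0, by linarith⟩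
  set χ : ℝ → ℂ := fun v => (b v : ℂ) with hχ
  have hc : ContDiff ℝ ∞ χ := Complex.ofRealCLM.contDiff.comp b.contDiff
  have hs : HasCompactSupport χ := b.hasCompactSupport.comp_left Complex.ofReal_zero
  refine ⟨χ, hc, hs, fun y => ?_⟩
  have hW := integrable_entireFourier_ofReal hc hs
  have hexp : ∀ t : ℝ, ∀ ξ : E 1, Complex.exp ((inner ℝ ξ (y - lineEquiv t) : ℝ) * Complex.I)
      = Complex.exp ((inner ℝ ξ y : ℝ) * Complex.I)
        * Complex.exp (-(t * (lineEquiv.symm ξ) * Complex.I)) := by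
    intro t ξ
    have h1 : inner ℝ ξ (lineEquiv t) = t * lineEquiv.symm ξ := by
      rw [← lineEquiv.symm.inner_map_map]
      simp
    rw [← Complex.exp_add, inner_sub_right, h1]
    congr 1
    push_cast
    ring
  have hprod : Integrable (fun p : ℝ × E 1 => entireFourier χ p.1
      * Complex.exp ((inner ℝ p.2 (y - lineEquiv p.1) : ℝ) * Complex.I)) (volume.prod Λ) := by
    refine (hW.comp_fst Λ).mul_bdd (c := 1) ?_ (Eventually.of_forall fun p => ?_)
    · have : Continuous fun p : ℝ × E 1 => lineEquiv p.1 :=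
        lineEquiv.continuous.comp continuous_fst
      exact (by fun_prop : Continuous _).aestronglyMeasurable
    · rw [Complex.norm_exp_ofReal_mul_I]
  have hcomplex : ∫ t : ℝ, entireFourier χ t * (f (y - lineEquiv t) : ℂ) = f y := by
    simp_rw [hfΛ, charFun_apply, ← integral_const_mul]
    rw [integral_integral_swap hprod]
    refine integral_congr_ae ?_
    filter_upwards [Measure.support_mem_ae (μ := Λ)] with ξ hξ
    simp_rw [hexp, mul_left_comm _ (Complex.exp ((inner ℝ ξ y : ℝ) * Complex.I))]
    rw [integral_const_mul, integral_entireFourier_mul_exp hc hs]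
    have h1 : b (lineEquiv.symm ξ / (2 * Real.pi)) = 1 := by
      refine b.one_of_mem_closedBall ?_
      rw [mem_closedBall_zero_iff, norm_div, lineEquiv.symm.norm_map]
      have h2 : ‖ξ‖ ≤ R := hR ξ hξ
      have h3 : (1 : ℝ) ≤ ‖2 * Real.pi‖ := by
        rw [Real.norm_of_nonneg Real.two_pi_pos.le]
        linarith [Real.pi_gt_three]
      exact (div_le_self (norm_nonneg _) h3).trans h2
    simp [hχ, h1]
  have hint : Integrable fun t : ℝ => entireFourier χ t * (f (y - lineEquiv t) : ℂ) := by
    simp_rw [hfΛ, charFun_apply, ← integral_const_mul]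
    exact hprod.integral_prod_left
  have hre := Complex.reCLM.integral_comp_comm hint
  rw [hcomplex] at hre
  simpa using hre

variable {φ lam : E 1 → ℝ} {H : Type*} [NormedAddCommGroup H]
  [InnerProductSpace ℝ H] [CompleteSpace H] [RKHS ℝ H (E 1) ℝ]

theorem integral_reproducing_coe (hl : IsPosDefType lam) (hk : HasKernel H lam) {r : ℝ → ℝ}
    (hr : Integrable r) (hrep : ∀ y, ∫ t, r t * lam (y - lineEquiv t) = lam y) (c : H)
    (y : E 1) : ∫ t, r t * c (y - lineEquiv t) = c y := by
  have hkc := continuous_kerFun H hl hk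
  have hint : Integrable fun t => r t • (RKHS.kerFun H (y - lineEquiv t) 1 : H) :=
    hr.smul_bdd (√(lam 0))
      ((hkc.comp (continuous_const.sub lineEquiv.continuous)).aestronglyMeasurable)
      (Eventually.of_forall fun t => norm_kerFun_one_le hk _)
  -- The identity for λ becomes a vector identity between kernel sections, which can be paired with
  -- any c.
  have hker : ∫ t, r t • (RKHS.kerFun H (y - lineEquiv t) 1 : H) = RKHS.kerFun H y 1 := by
    apply RKHS.ext
    intro x
    rw [← inner_kerFun_one, real_inner_comm, ← integral_inner hint, kerFun_one_apply hk,
      ← hl.symm, neg_sub, ← hrep]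
    congr 1
    ext t
    rw [inner_smul_right, real_inner_comm, inner_kerFun_one, kerFun_one_apply hk, ← hl.symm]
    congr 2
    abel
  rw [← inner_kerFun_one, ← hker, ← integral_inner hint]
  congr 1
  ext t
  rw [inner_smul_right, inner_kerFun_one]

theorem convFun_apply {d : ℕ} (f g : E d → ℝ) (y : E d) :
    convFun f g y = ∫ s, f s * g (y - s) := rfl

theorem convFun_apply' {d : ℕ} (f g : E d → ℝ) (y : E d) :
    convFun f g y = ∫ s, f (y - s) * g s := by
  rw [convFun_apply, ← integral_sub_left_eq_self _ _ y]
  simp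

theorem integral_reproducing_convFun_of_right (hl : IsPosDefType lam) (hk : HasKernel H lam)
    (hφ : Integrable φ) {r : ℝ → ℝ} (hr : Integrable r)
    (hrep : ∀ y, ∫ t, r t * lam (y - lineEquiv t) = lam y) (c : H) (y : E 1) :
    ∫ t, r t * convFun φ c (y - lineEquiv t) = convFun φ c y := by
  have hc := continuous_coe hl hk c
  have hL := lineEquiv.continuous
  have hprod : Integrable (fun p : ℝ × E 1 => r p.1 * φ p.2 * c (y - lineEquiv p.1 - p.2))
      (volume.prod volume) := by
    refine (hr.mul_prod hφ).mul_bdd (c := ‖c‖ * √(lam 0)) ?_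
      (Eventually.of_forall fun p => abs_apply_le hk c _)
    have h1 : Continuous fun p : ℝ × E 1 => y - lineEquiv p.1 - p.2 :=
      (continuous_const.sub (hL.comp continuous_fst)).sub continuous_snd
    exact (hc.comp h1).aestronglyMeasurable
  simp_rw [convFun_apply, ← integral_const_mul, ← mul_assoc]
  rw [integral_integral_swap hprod]
  congr 1
  ext s
  rw [← integral_reproducing_coe hl hk hr hrep c (y - s), ← integral_const_mul]
  congr 1
  ext t
  rw [sub_right_comm]
  ring

/-- Here φ is the band-limited factor, so the convolution is first commuted to let r act on φ. -/
theorem integral_reproducing_convFun_of_left (hp : IsPosDefType φ) (hl : IsPosDefType lam)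
    (hk : HasKernel H lam) (hφ : Integrable φ) {r : ℝ → ℝ} (hr : Integrable r)
    (hrep : ∀ y, ∫ t, r t * φ (y - lineEquiv t) = φ y) (c : H) (y : E 1) :
    ∫ t, r t * convFun φ c (y - lineEquiv t) = convFun φ c y := by
  have hc := continuous_coe hl hk c
  have hL := lineEquiv.continuous
  have hpc := hp.continuous
  have hprod : Integrable (fun p : ℝ × E 1 => r p.1 * φ (y - lineEquiv p.1 - p.2) * c p.2)
      (volume.prod volume) := by
    refine Integrable.mul_bdd (c := ‖c‖ * √(lam 0)) ?_
      (hc.comp continuous_snd).aestronglyMeasurable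
      (Eventually.of_forall fun p => abs_apply_le hk c _)
    have h1 : Continuous fun p : ℝ × E 1 => φ (y - lineEquiv p.1 - p.2) :=
      hpc.comp ((continuous_const.sub (hL.comp continuous_fst)).sub continuous_snd)
    have h3 : AEStronglyMeasurable (fun p : ℝ × E 1 => r p.1 * φ (y - lineEquiv p.1 - p.2))
        (volume.prod volume) := hr.aestronglyMeasurable.comp_fst.mul h1.aestronglyMeasurable
    rw [integrable_prod_iff h3]
    refine ⟨Eventually.of_forall fun t => (hφ.comp_sub_left (y - lineEquiv t)).const_mul (r t), ?_⟩
    have h2 : ∀ t : ℝ, ∫ s, ‖r t * φ (y - lineEquiv t - s)‖ = ‖r t‖ * ∫ s, ‖φ s‖ := by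
      intro t
      simp_rw [norm_mul]
      rw [integral_const_mul, integral_sub_left_eq_self (fun s => ‖φ s‖)]
    simp_rw [h2]
    exact hr.norm.mul_const _
  simp_rw [convFun_apply', ← integral_const_mul, ← mul_assoc]
  rw [integral_integral_swap hprod]
  congr 1
  ext s
  rw [← hrep, ← integral_mul_const]
  congr 1
  ext t
  rw [sub_right_comm]

theorem analyticOnNhd_convFun_line (hp : IsPosDefType φ) (hφ : Integrable φ)
    (hl : IsPosDefType lam) (hk : HasKernel H lam)
    (hb : HasBoundedSpectrum lam ∨ HasBoundedSpectrum φ) (c : H) :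
    AnalyticOnNhd ℝ (fun s => convFun φ c (lineEquiv s)) Set.univ := by
  obtain ⟨χ, hc, hs, hrep⟩ : ∃ χ : ℝ → ℂ, ContDiff ℝ ∞ χ ∧ HasCompactSupport χ ∧
      ∀ y, ∫ t : ℝ, (entireFourier χ t).re * convFun φ c (y - lineEquiv t) = convFun φ c y := by
    rcases hb with hb | hb
    · obtain ⟨χ, hc, hs, hrep⟩ := exists_reproducing_kernel hb
      exact ⟨χ, hc, hs, integral_reproducing_convFun_of_right hl hk hφ
        (integrable_entireFourier_ofReal hc hs).re hrep c⟩
    · obtain ⟨χ, hc, hs, hrep⟩ := exists_reproducing_kernel hb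
      exact ⟨χ, hc, hs, integral_reproducing_convFun_of_left hp hl hk hφ
        (integrable_entireFourier_ofReal hc hs).re hrep c⟩
  refine analyticOnNhd_of_eq_convolution hc hs
    ((continuous_convFun hl hk hφ c).comp lineEquiv.continuous)
    (fun t => abs_convFun_le hl hk hφ c _) fun x => ?_
  rw [← hrep]
  simp_rw [map_sub]

/-- The extremal set of the dual certificate is discrete. -/
theorem not_accPt_abs_convFun_div_eq_one (hp : IsPosDefType φ) (hφ : Integrable φ)
    (hl : IsPosDefType lam) (h0 : Tendsto lam (cocompact (E 1)) (𝓝 0)) (hk : HasKernel H lam)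
    (hb : HasBoundedSpectrum lam ∨ HasBoundedSpectrum φ) (c : H) (κ : ℝ) (x : E 1) :
    ¬ AccPt x (𝓟 {x | |convFun φ c x / κ| = 1}) := by
  intro hx
  set u : ℝ → ℝ := fun s => convFun φ c (lineEquiv s) / κ
  -- Squaring replaces |u| = 1 by an analytic equation, to which the identity theorem applies.
  have hu : AnalyticOnNhd ℝ (fun s => u s ^ 2) Set.univ :=
    ((analyticOnNhd_convFun_line hp hφ hl hk hb c).div_const).pow 2
  rw [accPt_iff_frequently_nhdsNE] at hx
  have hfreq : ∃ᶠ s in 𝓝[≠] (lineEquiv.symm x), u s ^ 2 = (fun _ => (1 : ℝ)) s := by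
    have ht : Tendsto lineEquiv.symm (𝓝[≠] x) (𝓝[≠] (lineEquiv.symm x)) :=
      lineEquiv.symm.continuous.continuousAt.tendsto.inf
        (tendsto_principal_principal.2 fun y hy => fun h => hy (lineEquiv.symm.injective h))
    refine ht.frequently (hx.mono fun y hy => ?_)
    have hy' : |convFun φ c y / κ| = 1 := hy
    simp only [u, lineEquiv.apply_symm_apply]
    rw [← sq_abs, hy', one_pow]
  have hone := hu.eq_of_frequently_eq analyticOnNhd_const hfreq
  have hlim : Tendsto (fun s => u s ^ 2) (cocompact ℝ) (𝓝 ((0 / κ) ^ 2)) :=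
    ((((tendsto_convFun_cocompact hl hk h0 hφ c).comp
      lineEquiv.toHomeomorph.isClosedEmbedding.tendsto_cocompact)).div_const κ).pow 2
  rw [hone] at hlim
  have := tendsto_nhds_unique hlim tendsto_const_nhds
  norm_num at this

end BandLimited

/-! ### The dual certificate and the atomic structure of solutions. -/

section Certificate

variable {d : ℕ} {φ lam : E d → ℝ} {H : Type*} [NormedAddCommGroup H] [InnerProductSpace ℝ H]
  [CompleteSpace H] [RKHS ℝ H (E d) ℝ]

theorem supNorm_le_iff {f : E d → ℝ} {κ : ℝ} (hκ : 0 ≤ κ) :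
    supNorm f ≤ ENNReal.ofReal κ ↔ ∀ x, |f x| ≤ κ := by
  rw [supNorm, iSup_le_iff]
  refine forall_congr' fun x => ?_
  rw [← ofReal_norm, ENNReal.ofReal_le_ofReal_iff hκ, Real.norm_eq_abs]

/-- The sup norm is dual to total variation: one direction is |∫ g dμ| ≤ ‖g‖_∞ ‖μ‖₁, the other tests
on ±δ_x. -/
theorem dualFeasible_iff (hp : IsPosDefType φ) (hd : IsProbDensity φ) (hl : IsPosDefType lam)
    (hk : HasKernel H lam) {κ : ℝ} (hκ : 0 ≤ κ) (c : H) :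
    DualFeasible φ κ c ↔
      DualBounded (tvSeminorm d) (embedConvₗ hp hd hl hk) κ c := by
  have hin : ∀ μ, inner ℝ c (embedConvₗ hp hd hl hk μ) = ∫ᵛ t, convFun φ c t ∂<•μ :=
    inner_embedConv hp hd hl hk c
  rw [DualFeasible, supNorm_le_iff hκ]
  constructor
  · intro h μ
    rw [hin]
    exact (le_abs_self _).trans (abs_integral_le_tvNorm h μ)
  · intro h x
    have hδ : tvNorm (Measure.dirac x).toSignedMeasure = 1 := by
      rw [tvNorm_toSignedMeasure]; simp
    have h1 := h (Measure.dirac x).toSignedMeasure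
    have h2 := h (-(Measure.dirac x).toSignedMeasure)
    rw [map_neg_eq_map (tvSeminorm d), map_neg (embedConvₗ hp hd hl hk), inner_neg_right] at h2
    rw [hin, VectorMeasure.integral_toSignedMeasure, integral_dirac, tvSeminorm_apply, hδ,
      mul_one] at h1 h2
    exact abs_le.2 ⟨by linarith, h1⟩

/-- The support of a signed measure lies in the extremal set of a dual certificate. -/
theorem support_subset_of_integral_eq_tvNorm {η : E d → ℝ} (hη : Continuous η)
    (h1 : ∀ x, |η x| ≤ 1) {μ : SignedMeasure (E d)} (hμ : ∫ᵛ x, η x ∂<•μ = tvNorm μ) :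
    μ.totalVariation.support ⊆ {x | |η x| = 1} := by
  have hi : ∀ m : Measure (E d), IsFiniteMeasure m → Integrable η m := fun m _ =>
    integrable_of_bounded hη h1 m
  set p := μ.toJordanDecomposition.posPart
  set q := μ.toJordanDecomposition.negPart
  have hip := hi p inferInstance
  have hiq := hi q inferInstance
  rw [integral_signed μ _ hip hiq, tvNorm_eq_posPart_add_negPart] at hμ
  have hp0 : 0 ≤ fun x => 1 - η x := fun x => sub_nonneg.2 (abs_le.1 (h1 x)).2
  have hq0 : 0 ≤ fun x => 1 + η x := fun x => by
    have := (abs_le.1 (h1 x)).1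
    simp only [Pi.zero_apply]
    linarith
  have ep : ∫ x, (1 - η x) ∂p = p.real Set.univ - ∫ x, η x ∂p := by
    rw [integral_sub (integrable_const _) hip]; simp
  have eq : ∫ x, (1 + η x) ∂q = q.real Set.univ + ∫ x, η x ∂q := by
    rw [integral_add (integrable_const _) hiq]; simp
  have np : 0 ≤ ∫ x, (1 - η x) ∂p := integral_nonneg hp0
  have nq : 0 ≤ ∫ x, (1 + η x) ∂q := integral_nonneg hq0
  -- The nonnegative integrals of 1 − η against p and 1 + η against q sum to zero, so η is 1 p-a.e.
  -- and −1 q-a.e. Closedness of {|η| = 1} then captures the support.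
  have zp := (integral_eq_zero_iff_of_nonneg hp0 ((integrable_const _).sub hip)).1
    (by linarith : ∫ x, (1 - η x) ∂p = 0)
  have zq := (integral_eq_zero_iff_of_nonneg hq0 ((integrable_const _).add hiq)).1
    (by linarith : ∫ x, (1 + η x) ∂q = 0)
  refine Measure.support_subset_of_isClosed (isClosed_eq hη.abs continuous_const) ?_
  rw [SignedMeasure.totalVariation]
  refine (ae_add_measure_iff (p := fun x => |η x| = 1)).2 ⟨?_, ?_⟩
  · filter_upwards [zp] with x hx
    have : η x = 1 := by simp only [Pi.zero_apply] at hx; linarith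
    simp [this]
  · filter_upwards [zq] with x hx
    have : η x = -1 := by simp only [Pi.zero_apply] at hx; linarith
    simp [this]

/-- Without accumulation points S is discrete, and a discrete Lindelöf space is countable. -/
theorem countable_of_forall_not_accPt {S : Set (E d)} (hS : ∀ x, ¬ AccPt x (𝓟 S)) :
    S.Countable := by
  have := discreteTopology_of_noAccPts fun x (_ : x ∈ S) => hS x
  exact countable_of_Lindelof_of_discrete (X := S)

/-- A signed measure with countable support is a sum of Dirac masses. -/
theorem hasSum_atoms (μ : SignedMeasure (E d)) (hc : μ.totalVariation.support.Countable)
    {B : Set (E d)} (hB : MeasurableSet B) :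
    HasSum (fun t : μ.totalVariation.support =>
      B.indicator (fun _ => μ {(t : E d)}) (t : E d)) (μ B) := by
  set S := μ.totalVariation.support
  have : Countable S := hc
  have h := VectorMeasure.hasSum_of_disjoint_iUnion (v := μ)
    (f := fun t : S => B ∩ {(t : E d)}) (fun t => hB.inter (measurableSet_singleton _))
    (fun s t hst => Set.disjoint_left.2 fun x hx hy =>
      hst (Subtype.ext (hx.2.symm.trans hy.2)))
  have hU : ⋃ t : S, B ∩ {(t : E d)} = B ∩ S := by
    rw [← Set.inter_iUnion, Set.iUnion_of_singleton_coe]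
  have hnull : μ (B \ S) = 0 := SignedMeasure.null_of_totalVariation_zero μ
    (measure_mono_null (fun x hx => hx.2) Measure.measure_compl_support)
  have hBS : μ (B ∩ S) = μ B := by
    have h1 := VectorMeasure.of_union (v := μ) (A := B ∩ S) (B := B \ S)
      (Set.disjoint_sdiff_inter.symm) (hB.inter hc.measurableSet) (hB.diff hc.measurableSet)
    rw [Set.inter_union_sdiff, hnull, add_zero] at h1
    exact h1.symm
  rw [hU, hBS] at h
  refine (congrArg (fun g => HasSum g (μ B)) (funext fun t => ?_)).mp h
  by_cases ht : (t : E d) ∈ B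
  · rw [Set.indicator_of_mem ht, Set.inter_eq_right.2 (Set.singleton_subset_iff.2 ht)]
  · rw [Set.indicator_of_notMem ht, Set.inter_singleton_eq_empty.2 ht, VectorMeasure.empty]

theorem primalObj_eq_penalized (hp : IsPosDefType φ) (hd : IsProbDensity φ)
    (hl : IsPosDefType lam) (hk : HasKernel H lam) (κ : ℝ) {n : ℕ} (X : Fin n → E d) :
    primalObj H φ κ X
      = penalized (tvSeminorm d) (embedConvₗ hp hd hl hk) (embed H (empirical X)) κ := rfl

theorem dualObj_eq_penalizedDual (hp : IsPosDefType φ) (hd : IsProbDensity φ)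
    (hl : IsPosDefType lam) (hk : HasKernel H lam) (κ : ℝ) {n : ℕ} (X : Fin n → E d) :
    dualObj (H := H) φ κ X
      = penalizedDual (tvSeminorm d) (embedConvₗ hp hd hl hk) (embed H (empirical X)) κ := rfl

theorem integral_convFun_div (hp : IsPosDefType φ) (hd : IsProbDensity φ) (hl : IsPosDefType lam)
    (hk : HasKernel H lam) (c : H) (κ : ℝ) (μ : SignedMeasure (E d)) :
    ∫ᵛ x, convFun φ c x / κ ∂<•μ = inner ℝ c (embedConvₗ hp hd hl hk μ) / κ := by
  have h : inner ℝ c (embedConvₗ hp hd hl hk μ) = ∫ᵛ t, convFun φ c t ∂<•μ :=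
    inner_embedConv hp hd hl hk c μ
  rw [h]
  simp_rw [div_eq_inv_mul]
  exact VectorMeasure.integral_fun_smul _ _ κ⁻¹ (convFun φ c)

/-- Optimality conditions for the primal program, in terms of the dual certificate. -/
theorem dualCertificate_of_isPrimalSol (hp : IsPosDefType φ) (hd : IsProbDensity φ)
    (hl : IsPosDefType lam) (hk : HasKernel H lam) {κ : ℝ} (hκ : 0 < κ) {n : ℕ}
    {X : Fin n → E d} {μ : SignedMeasure (E d)} (hμ : IsPrimalSol H φ κ X μ) {c : H}
    (hc : c = embed H (empirical X) - embedConv H φ μ) :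
    μ.totalVariation.support ⊆ {x | |convFun φ c x / κ| = 1} ∧
      ∫ᵛ x, convFun φ c x / κ ∂<•μ = tvNorm μ ∧
      ∀ ν : SignedMeasure (E d),
        tvNorm μ + ∫ᵛ x, convFun φ c x / κ ∂<•(ν - μ) ≤ tvNorm ν := by
  rw [IsPrimalSol, primalObj_eq_penalized hp hd hl hk] at hμ
  have hb : DualBounded (tvSeminorm d) (embedConvₗ hp hd hl hk) κ c := by
    rw [hc]
    exact inner_residual_le_of_minimizer hκ hμ
  have hself : ∫ᵛ x, convFun φ c x / κ ∂<•μ = tvNorm μ := by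
    rw [integral_convFun_div hp hd hl hk, hc, div_eq_iff hκ.ne', mul_comm]
    exact inner_residual_self_of_minimizer hκ hμ
  have hle : ∀ x, |convFun φ c x / κ| ≤ 1 := by
    intro x
    rw [abs_div, abs_of_pos hκ, div_le_one hκ]
    exact (supNorm_le_iff hκ.le).1 ((dualFeasible_iff hp hd hl hk hκ.le c).2 hb) x
  refine ⟨support_subset_of_integral_eq_tvNorm
    ((continuous_convFun hl hk hd.integrable c).div_const κ) hle hself, hself, fun ν => ?_⟩
  have h1 : inner ℝ c (embedConvₗ hp hd hl hk ν) / κ ≤ tvNorm ν := by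
    rw [div_le_iff₀ hκ, mul_comm]
    exact hb ν
  rw [integral_convFun_div hp hd hl hk] at hself ⊢
  rw [map_sub, inner_sub_right, sub_div, hself]
  linarith

end Certificate

end Blasso

end

theorem theorem6 (d : ℕ) (φ lam : Blasso.E d → ℝ)
    (hφ : Blasso.IsPosDefType φ) (hφd : Blasso.IsProbDensity φ)
    (hlam : Blasso.IsPosDefType lam) (hlam0 : Tendsto lam (cocompact (Blasso.E d)) (𝓝 0))
    {H : Type*} [NormedAddCommGroup H] [InnerProductSpace ℝ H] [CompleteSpace H]
    [RKHS ℝ H (Blasso.E d) ℝ] (hH : Blasso.HasKernel H lam)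
    (n : ℕ) (hn : 0 < n) (X : Fin n → Blasso.E d) (κ : ℝ) (hκ : 0 < κ) :
    ∃ (z : H) (m : ℝ) (c : H) (η : Blasso.E d → ℝ),
      -- (i) existence, and invariance of `L ∘ Φ μ` and of the total variation norm
      ((∃ μ, Blasso.IsPrimalSol H φ κ X μ) ∧
        ∀ μ, Blasso.IsPrimalSol H φ κ X μ → Blasso.embedConv H φ μ = z ∧ Blasso.tvNorm μ = m) ∧
      -- (ii) the dual program, strong duality, and the unique dual solution
      ((∀ b : H,
          (Blasso.DualFeasible φ κ b → Blasso.dualObj φ κ X b =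
            ((‖Blasso.embed H (Blasso.empirical X)‖ ^ 2 / 2
              - 1 / 2 * ‖Blasso.embed H (Blasso.empirical X) - b‖ ^ 2 : ℝ) : EReal)) ∧
          (¬ Blasso.DualFeasible φ κ b → Blasso.dualObj φ κ X b = ⊥)) ∧
        (⨆ b : H, Blasso.dualObj φ κ X b) =
          ((‖Blasso.embed H (Blasso.empirical X)‖ ^ 2 / 2 : ℝ) : EReal)
            - ⨅ b : {b : H // Blasso.DualFeasible φ κ b},
                ((1 / 2 * ‖Blasso.embed H (Blasso.empirical X) - (b : H)‖ ^ 2 : ℝ) : EReal) ∧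
        (⨅ μ, (Blasso.primalObj H φ κ X μ : EReal)) = (⨆ b : H, Blasso.dualObj φ κ X b) ∧
        (∀ b : H, Blasso.IsDualSol φ κ X b ↔ b = c) ∧
        c = Blasso.embed H (Blasso.empirical X) - z) ∧
      -- (iii) `η = Φ c / κ` is a sub-gradient of the total variation norm at every primal solution
      (η = (fun x => Blasso.convFun φ c x / κ) ∧
        ∀ μ, Blasso.IsPrimalSol H φ κ X μ →
          μ.totalVariation.support ⊆ {x | |η x| = 1} ∧
          ∫ᵛ x, η x ∂<•μ = m ∧
          ∀ ν : SignedMeasure (Blasso.E d),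
            Blasso.tvNorm μ + ∫ᵛ x, η x ∂<•(ν - μ) ≤ Blasso.tvNorm ν) ∧
      -- (iv) discreteness in dimension one
      (d = 1 → (Blasso.HasBoundedSpectrum lam ∨ Blasso.HasBoundedSpectrum φ) →
        (∀ x, ¬ AccPt x (𝓟 {x | |η x| = 1})) ∧
        ∀ μ, Blasso.IsPrimalSol H φ κ X μ →
          μ.totalVariation.support.Countable ∧
          (∀ x, ¬ AccPt x (𝓟 μ.totalVariation.support)) ∧
          ∃ a : μ.totalVariation.support → ℝ,
            ∀ B : Set (Blasso.E d), MeasurableSet B →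
              HasSum (fun t : μ.totalVariation.support => B.indicator (fun _ => a t) (t : Blasso.E d))
                (μ B)) := by
  obtain ⟨μ₀, hμ₀⟩ := Blasso.exists_isPrimalSol hφ hφd hlam hlam0 hH hκ X
  have hv := hμ₀
  rw [Blasso.IsPrimalSol, Blasso.primalObj_eq_penalized hφ hφd hlam hH] at hv
  have hfeas := Blasso.dualFeasible_iff hφ hφd hlam hH hκ.le (κ := κ)
  have huniq : ∀ μ, Blasso.IsPrimalSol H φ κ X μ →
      Blasso.embedConv H φ μ = Blasso.embedConv H φ μ₀ ∧ Blasso.tvNorm μ = Blasso.tvNorm μ₀ := by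
    intro μ hμ
    rw [Blasso.IsPrimalSol, Blasso.primalObj_eq_penalized hφ hφd hlam hH] at hμ
    exact Blasso.minimizer_unique hκ hμ hv
  -- The certificate built from μ₀ serves every solution, since L∘Φμ does not depend on the
  -- solution.
  have hcert : ∀ μ, Blasso.IsPrimalSol H φ κ X μ → _ := fun μ hμ =>
    Blasso.dualCertificate_of_isPrimalSol hφ hφd hlam hH hκ hμ
      (congrArg (Blasso.embed H (Blasso.empirical X) - ·) (huniq μ hμ).1.symm)
  refine ⟨Blasso.embedConv H φ μ₀, Blasso.tvNorm μ₀,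
    Blasso.embed H (Blasso.empirical X) - Blasso.embedConv H φ μ₀, _, ⟨⟨μ₀, hμ₀⟩, huniq⟩,
    ⟨fun b => ⟨fun hb => ?_, fun hb => ?_⟩, ?_, ?_, fun b => ?_, rfl⟩,
    ⟨rfl, fun μ hμ => ⟨(hcert μ hμ).1, (hcert μ hμ).2.1.trans (huniq μ hμ).2,
      (hcert μ hμ).2.2⟩⟩, ?_⟩
  · rw [Blasso.dualObj_eq_penalizedDual hφ hφd hlam hH]
    exact Blasso.iInf_penalizedLagrangian_of_feasible ((hfeas b).1 hb)
  · rw [Blasso.dualObj_eq_penalizedDual hφ hφd hlam hH]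
    exact Blasso.iInf_penalizedLagrangian_of_not_feasible (fun h => hb ((hfeas b).2 h))
  · rw [Blasso.dualObj_eq_penalizedDual hφ hφd hlam hH, Blasso.iSup_penalizedDual hκ hv,
      Blasso.iInf_norm_sub_sq_of_dualBounded hκ hv hfeas, EReal.coe_sub]
  · rw [Blasso.dualObj_eq_penalizedDual hφ hφd hlam hH,
      Blasso.primalObj_eq_penalized hφ hφd hlam hH]
    exact Blasso.iInf_penalized_eq_iSup_penalizedDual hκ hv
  · rw [Blasso.IsDualSol, Blasso.dualObj_eq_penalizedDual hφ hφd hlam hH]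
    exact Blasso.forall_penalizedDual_le_iff hκ hv b
  · rintro rfl hb
    have hacc := Blasso.not_accPt_abs_convFun_div_eq_one hφ hφd.integrable hlam hlam0 hH hb
      (Blasso.embed H (Blasso.empirical X) - Blasso.embedConv H φ μ₀) κ
    refine ⟨hacc, fun μ hμ => ?_⟩
    have hacc' : ∀ x, ¬ AccPt x (𝓟 μ.totalVariation.support) := fun x hx =>
      hacc x (hx.mono (principal_mono.2 (hcert μ hμ).1))
    have hcount := Blasso.countable_of_forall_not_accPt hacc'
    exact ⟨hcount, hacc', fun t => μ {(t : Blasso.E 1)}, fun B hB =>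
      Blasso.hasSum_atoms μ hcount hB⟩
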